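/- **Language.** Values are $\mathrm{Val}=\mathbb N\cup\{\bot\}$. Registers are the program counter $pc$, the stack pointer $sp$ and arbitrary further identifiers. Expressions are $e::=v\mid x\mid\ominus e\mid e_1\otimes e_2$, for arbitrary families of unary and binary operators that are total functions on values. Instructions are skip, $x\leftarrow e$, $\mathrm{load}\,x,e$, $\mathrm{store}\,x,e$, $\mathrm{jmp}\,e$, $\mathrm{beqz}\,x,l$, conditional assignment $x\leftarrow e$ if $e'=0$, speculation barrier, $\mathrm{call}\,f$, ret. A program $p$ consists of a finite partial map from $\mathbb N$ to instructions, a finite partial map $\mathcal F$ from function names to addresses, and an entry address. A configuration $\sigma=\langle m,a\rangle$ is a memory $m:\mathbb N\to\mathrm{Val}$ and a register file $a$; it is initial if $a(pc)$ is the entry address, and final if $a(pc)=\bot$. Reading memory at $\bot$ gives $\bot$, writing at $\bot$ does nothing, $\bot\pm8=\bot$, and $n-8=\bot$ for $n<8$. **Non-speculative semantics.** This is the usual small-step semantics. Loads, stores, jumps/branches, calls and returns emit $\mathrm{load}\,n$, $\mathrm{store}\,n$, $\mathrm{pc}\,l$, $\mathrm{call}\,f$, $\mathrm{ret}\,l$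 (the address accessed, the new program counter, the function, the return address); the other instructions emit nothing. Assignments, conditional assignments and loads to $pc$ cannot be executed. A call to $f$ with $\mathcal F(f)=n$ decreases $sp$ by $8$, stores $a(pc)+1$ at the new $sp$ and sets $pc:=n$ (it is stuck if $\mathcal F(f)$ is undefined); ret sets $pc:=m(a(sp))$ and increases $sp$ by $8$. If there is no instruction at $a(pc)\in\mathbb N$, the step sets $pc:=\bot$ and emits $\mathrm{pc}\,\bot$. The behaviour $Beh_{NS}(p)$ is the set of traces of $p$ from an initial to a final configuration. The symbolic version replaces register and memory contents by symbolic terms over the initial contents, keeps $pc$ concrete, and records path conditions in the trace; $\gamma(\tau)$ is the set of concrete traces obtained from a symbolic trace $\tau$ under valuations satisfying all its path conditions. **Always-mispredict (AM) semantics.** Fix the maximal speculation window $\omega\in\mathbb N$ and the maximal size $N\in\mathbb N$ of the return stack buffer (RSB). A state is a stack of instances $\langle ctr,\sigma,R,n\rangle$, where $R$ is the RSB and $n\in\mathbb N\cup\{\bot\}$ is the remaining window, $\bot$ meaning no speculation ($\bot-1=\bot$, $\min(\omega,\bot)=\omega$). Only the top instance steps, it needs $n\neq0$, its configuration makes a non-speculative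 step, and $n$ decreases by $1$. In addition: a barrier sets a window $n\ne\bot$ to $0$; a call pushes $a(pc)+1$ on $R$ if $|R|<N$, and leaves $R$ unchanged otherwise; a ret with empty $R$ does nothing more; a ret with $R=R'\cdot l$ pops $l$, and if $l\ne m(a(sp))$ it emits, after the observation of the step, $\mathrm{start}\,ctr\cdot\mathrm{ret}\,l$ and pushes the instance $\langle ctr+1,\ \sigma[pc\mapsto l,sp\mapsto a(sp)+8],\ R',\ \min(\omega,n')\rangle$, where $\sigma$ is the configuration before the ret and $n'$ the decreased window. If an instance that lies above another one is on top and has window $0$ or is stuck, it is popped with the observation $\mathrm{rollback}\,ctr$, where $ctr$ is the counter of the instance below, which then takes over the counter of the popped instance. The symbolic semantics is the same with symbolic configurations and steps. **Oracle semantics.** Instances also carry a history of the returns that met a mismatching RSB entry (address of the ret, counter, address where execution continued; a speculating ret extends the history of both the old and the new instance). An oracle $O$ maps the program, the history and the address of the ret to a window in $\{0,\dots,\omega\}$, which becomes the window of the new instance. Every step other than a rollback is possible only if all windows of the stack are nonzero, and decreases all windows of the old stack by $1$ (a barrier sets all windows $\neq\bot$ to $0$). If some windows are $0$, the topmost such instance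 is rolled back, with everything above it deleted; if none is, and the top instance is speculative and stuck, it is rolled back. The instance below takes over the counter of the former top. Otherwise the rules are those of AM. **Behaviours and SNI.** In all speculative semantics runs start from the single instance with counter $0$, empty RSB and history, window $\bot$ and an initial configuration, and terminate in a single instance with a final configuration. $Beh_R(p)$, $Beh_{R,O}(p)$ and $Beh^{sym}_R(p)$ are the sets of traces of terminating runs of the AM, oracle and symbolic semantics (the symbolic one from the initial configuration in which every register but $pc$ and the memory is a fresh symbol). The projection $\tau{\restriction}_{ns}$ deletes every subtrace from $\mathrm{start}\,i$ to $\mathrm{rollback}\,i$. A policy $P$ is a list of registers and memory locations; $\sigma^1\sim_P\sigma^2$ means agreement on these. Program $p$ satisfies SNI for $P$ in a (concrete) semantics if for all initial $\sigma^1\sim_P\sigma^2$ with terminating traces $\tau^1,\tau^2$, $\tau^1{\restriction}_{ns}=\tau^2{\restriction}_{ns}$ implies $\tau^1=\tau^2$. **Theorem.** For all operators, register and function names, and all $\omega,N\in\mathbb N$, the semantics Spec-R (acyclic RSB of size at most $N$) is a secure speculative semantics, that is, for every program $p$: 1. (Oracle over-approximation) for every policy $P$, $p$ satisfies SNI for $P$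 in the oracle semantics for *every* oracle $O$ if and only if $p$ satisfies SNI for $P$ in the AM semantics; 2. (Symbolic consistency) $Beh_R(p)=\bigcup_{\tau\in Beh^{sym}_R(p)}\gamma(\tau)$; 3. (Non-speculative consistency) $\{\tau{\restriction}_{ns}:\tau\in Beh_R(p)\}=Beh_{NS}(p)=\{\tau{\restriction}_{ns}:\tau\in Beh_{R,O}(p)\}$ for every oracle $O$. -/

import Mathlib

namespace MuAsm

/-! ### Syntax of the assembly language -/

/-- Values: natural numbers together with `⊥`, represented by `none`. -/
abbrev Val := Option ℕ

/-- The parameters that the language leaves open: the register identifiers other than `pc` and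
`sp`, the function names, and the unary and binary operators with their meaning on values. -/
structure Lang where
  GReg : Type
  Func : Type
  UnOp : Type
  BinOp : Type
  evalUn : UnOp → Val → Val
  evalBin : BinOp → Val → Val → Val

variable {L : Lang}

inductive Reg (L : Lang) where
  | pc : Reg L
  | sp : Reg L
  | gen : L.GReg → Reg L

inductive Expr (L : Lang) where
  | val : Val → Expr L
  | reg : Reg L → Expr L
  | un : L.UnOp → Expr L → Expr L
  | bin : L.BinOp → Expr L → Expr L → Expr L

/-- `cmov x e c` is the conditional assignment of `e` to `x`, performed if `c` is `0`;
`store x e` writes the content of the register `x` to the address `e`. -/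
inductive Instr (L : Lang) where
  | skip : Instr L
  | assign : Reg L → Expr L → Instr L
  | load : Reg L → Expr L → Instr L
  | store : Reg L → Expr L → Instr L
  | jmp : Expr L → Instr L
  | beqz : Reg L → Val → Instr L
  | cmov : Reg L → Expr L → Expr L → Instr L
  | barrier : Instr L
  | call : L.Func → Instr L
  | ret : Instr L

/-- A program: a finite map from addresses to instructions, the finite map from function names to
the addresses where they start, and the address where execution starts. -/
structure Program (L : Lang) where
  code : ℕ → Option (Instr L)
  code_finite : {n | code n ≠ none}.Finite
  funs : L.Func → Option ℕ
  funs_finite : {f | funs f ≠ none}.Finite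
  entry : ℕ

/-- The instruction at a value of the program counter (`none` if there is none). -/
def Program.instrAt (p : Program L) : Val → Option (Instr L)
  | none => none
  | some n => p.code n

/-! ### Observations, traces, non-speculative projection -/

inductive Obs (L : Lang) where
  | load : Val → Obs L
  | store : Val → Obs L
  | pc : Val → Obs L
  | call : L.Func → Obs L
  | ret : Val → Obs L
  | start : ℕ → Obs L
  | rollback : ℕ → Obs L

/-- Traces; a step with the empty observation contributes the empty list. -/
abbrev Trace (L : Lang) := List (Obs L)

/-- Auxiliary scan: `some i` means that we are inside the transaction `i` and wait for
its rollback, `none` that we are outside of all transactions. -/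
def nsProjAux : Option ℕ → Trace L → Trace L
  | _, [] => []
  | none, Obs.start i :: t => nsProjAux (some i) t
  | none, o :: t => o :: nsProjAux none t
  | some i, Obs.rollback j :: t => if j = i then nsProjAux none t else nsProjAux (some i) t
  | some i, _ :: t => nsProjAux (some i) t

/-- The non-speculative projection: delete every subtrace from `start i` to `rollback i`. -/
def nsProj (t : Trace L) : Trace L := nsProjAux none t

/-- Reflexive-transitive closure of a labelled step relation, concatenating the labels. -/
inductive Steps {S E : Type} (step : S → List E → S → Prop) : S → List E → S → Prop where
  | refl (s : S) : Steps step s [] s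
  | head {s s' s'' : S} {t t' : List E} :
      step s t s' → Steps step s' t' s'' → Steps step s (t ++ t') s''

/-! ### Concrete configurations and the non-speculative semantics -/

abbrev Mem := ℕ → Val

/-- A read at the address `⊥` yields `⊥`. -/
def Mem.read (m : Mem) : Val → Val
  | none => none
  | some n => m n

/-- A write at the address `⊥` has no effect. -/
def Mem.write (m : Mem) : Val → Val → Mem
  | none, _ => m
  | some n, v => Function.update m n v

/-- `v + 8`, with `⊥ + 8 = ⊥`. -/
def Val.add8 : Val → Val
  | none => none
  | some n => some (n + 8)

/-- `v - 8`; it is `⊥` if the difference is not a natural number. -/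
def Val.sub8 : Val → Val
  | none => none
  | some n => if 8 ≤ n then some (n - 8) else none

structure Config (L : Lang) where
  mem : Mem
  reg : Reg L → Val

open Classical in
/-- Update of a register file with values in an arbitrary type. -/
noncomputable def setReg {α : Type} (a : Reg L → α) (x : Reg L) (v : α) : Reg L → α :=
  Function.update a x v

def Expr.eval (a : Reg L → Val) : Expr L → Val
  | .val v => v
  | .reg x => a x
  | .un o e => L.evalUn o (e.eval a)
  | .bin o e₁ e₂ => L.evalBin o (e₁.eval a) (e₂.eval a)

/-- The non-speculative step relation of a program. -/
inductive NSStep (p : Program L) : Config L → Trace L → Config L → Prop where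
  | skip {m : Mem} {a : Reg L → Val} {n : ℕ} :
      a .pc = some n → p.code n = some .skip →
      NSStep p ⟨m, a⟩ [] ⟨m, setReg a .pc (some (n + 1))⟩
  | barrier {m : Mem} {a : Reg L → Val} {n : ℕ} :
      a .pc = some n → p.code n = some .barrier →
      NSStep p ⟨m, a⟩ [] ⟨m, setReg a .pc (some (n + 1))⟩
  | assign {m : Mem} {a : Reg L → Val} {n : ℕ} {x : Reg L} {e : Expr L} :
      a .pc = some n → p.code n = some (.assign x e) → x ≠ .pc →
      NSStep p ⟨m, a⟩ [] ⟨m, setReg (setReg a x (e.eval a)) .pc (some (n + 1))⟩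
  | cmovSat {m : Mem} {a : Reg L → Val} {n : ℕ} {x : Reg L} {e c : Expr L} :
      a .pc = some n → p.code n = some (.cmov x e c) → x ≠ .pc → c.eval a = some 0 →
      NSStep p ⟨m, a⟩ [] ⟨m, setReg (setReg a x (e.eval a)) .pc (some (n + 1))⟩
  | cmovUnsat {m : Mem} {a : Reg L → Val} {n : ℕ} {x : Reg L} {e c : Expr L} :
      a .pc = some n → p.code n = some (.cmov x e c) → x ≠ .pc → c.eval a ≠ some 0 →
      NSStep p ⟨m, a⟩ [] ⟨m, setReg a .pc (some (n + 1))⟩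
  | load {m : Mem} {a : Reg L → Val} {n : ℕ} {x : Reg L} {e : Expr L} :
      a .pc = some n → p.code n = some (.load x e) → x ≠ .pc →
      NSStep p ⟨m, a⟩ [.load (e.eval a)]
        ⟨m, setReg (setReg a x (m.read (e.eval a))) .pc (some (n + 1))⟩
  | store {m : Mem} {a : Reg L → Val} {n : ℕ} {x : Reg L} {e : Expr L} :
      a .pc = some n → p.code n = some (.store x e) →
      NSStep p ⟨m, a⟩ [.store (e.eval a)]
        ⟨m.write (e.eval a) (a x), setReg a .pc (some (n + 1))⟩
  | jmp {m : Mem} {a : Reg L → Val} {n : ℕ} {e : Expr L} :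
      a .pc = some n → p.code n = some (.jmp e) →
      NSStep p ⟨m, a⟩ [.pc (e.eval a)] ⟨m, setReg a .pc (e.eval a)⟩
  | beqzSat {m : Mem} {a : Reg L → Val} {n : ℕ} {x : Reg L} {l : Val} :
      a .pc = some n → p.code n = some (.beqz x l) → a x = some 0 →
      NSStep p ⟨m, a⟩ [.pc l] ⟨m, setReg a .pc l⟩
  | beqzUnsat {m : Mem} {a : Reg L → Val} {n : ℕ} {x : Reg L} {l : Val} :
      a .pc = some n → p.code n = some (.beqz x l) → a x ≠ some 0 →
      NSStep p ⟨m, a⟩ [.pc (some (n + 1))] ⟨m, setReg a .pc (some (n + 1))⟩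
  | call {m : Mem} {a : Reg L → Val} {n k : ℕ} {f : L.Func} :
      a .pc = some n → p.code n = some (.call f) → p.funs f = some k →
      NSStep p ⟨m, a⟩ [.call f]
        ⟨m.write (Val.sub8 (a .sp)) (some (n + 1)),
          setReg (setReg a .sp (Val.sub8 (a .sp))) .pc (some k)⟩
  | ret {m : Mem} {a : Reg L → Val} {n : ℕ} :
      a .pc = some n → p.code n = some .ret →
      NSStep p ⟨m, a⟩ [.ret (m.read (a .sp))]
        ⟨m, setReg (setReg a .sp (Val.add8 (a .sp))) .pc (m.read (a .sp))⟩
  | terminate {m : Mem} {a : Reg L → Val} {n : ℕ} :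
      a .pc = some n → p.code n = none →
      NSStep p ⟨m, a⟩ [.pc none] ⟨m, setReg a .pc none⟩

/-- No non-speculative step is possible. -/
def Stuck (p : Program L) (σ : Config L) : Prop := ¬ ∃ t σ', NSStep p σ t σ'

def Config.Initial (p : Program L) (σ : Config L) : Prop := σ.reg .pc = some p.entry

def Config.Final (σ : Config L) : Prop := σ.reg .pc = none

/-- `p` produces the trace `t` from `σ` until termination, non-speculatively. -/
def NSTrace (p : Program L) (σ : Config L) (t : Trace L) : Prop :=
  ∃ σ', Steps (NSStep p) σ t σ' ∧ σ'.Final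

/-- The non-speculative behaviour of a program. -/
def behNS (p : Program L) : Set (Trace L) := {t | ∃ σ, σ.Initial p ∧ NSTrace p σ t}

/-! ### Symbolic configurations and the symbolic non-speculative semantics -/

mutual
/-- Symbolic expressions. `sym x` is the symbol for the initial content of the register `x`;
`ite c e e'` is `e` if `c` is `0` and `e'` otherwise; `add8`, `sub8` shift the stack pointer. -/
inductive SExpr (L : Lang) where
  | val : Val → SExpr L
  | sym : Reg L → SExpr L
  | un : L.UnOp → SExpr L → SExpr L
  | bin : L.BinOp → SExpr L → SExpr L → SExpr L
  | ite : SExpr L → SExpr L → SExpr L → SExpr L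
  | add8 : SExpr L → SExpr L
  | sub8 : SExpr L → SExpr L
  | read : SMem L → SExpr L → SExpr L
/-- Symbolic memories: the symbol for the initial memory, and symbolic writes. -/
inductive SMem (L : Lang) where
  | sym : SMem L
  | write : SMem L → SExpr L → SExpr L → SMem L
end

/-- Valuations of the symbols: a value for every register symbol and a memory for the memory
symbol. -/
abbrev Valuation (L : Lang) := Config L

mutual
def SExpr.eval (μ : Valuation L) : SExpr L → Val
  | .val v => v
  | .sym x => μ.reg x
  | .un o e => L.evalUn o (e.eval μ)
  | .bin o e₁ e₂ => L.evalBin o (e₁.eval μ) (e₂.eval μ)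
  | .ite c e e' => if c.eval μ = some 0 then e.eval μ else e'.eval μ
  | .add8 e => Val.add8 (e.eval μ)
  | .sub8 e => Val.sub8 (e.eval μ)
  | .read m e => (m.eval μ).read (e.eval μ)
def SMem.eval (μ : Valuation L) : SMem L → Mem
  | .sym => μ.mem
  | .write m e e' => (m.eval μ).write (e.eval μ) (e'.eval μ)
end

/-- Path conditions `e = v` and `e ≠ v`. -/
inductive PathCond (L : Lang) where
  | eq : SExpr L → Val → PathCond L
  | ne : SExpr L → Val → PathCond L

def PathCond.Holds (μ : Valuation L) : PathCond L → Prop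
  | .eq e v => e.eval μ = v
  | .ne e v => e.eval μ ≠ v

/-- Symbolic observations; the path conditions are part of the symbolic trace. -/
inductive SObs (L : Lang) where
  | cond : PathCond L → SObs L
  | load : SExpr L → SObs L
  | store : SExpr L → SObs L
  | pc : Val → SObs L
  | call : L.Func → SObs L
  | ret : Val → SObs L
  | start : ℕ → SObs L
  | rollback : ℕ → SObs L

abbrev STrace (L : Lang) := List (SObs L)

/-- The concrete observation under a valuation; path conditions are erased. -/
def SObs.conc (μ : Valuation L) : SObs L → Option (Obs L)
  | .cond _ => none
  | .load e => some (.load (e.eval μ))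
  | .store e => some (.store (e.eval μ))
  | .pc v => some (.pc v)
  | .call f => some (.call f)
  | .ret v => some (.ret v)
  | .start i => some (.start i)
  | .rollback i => some (.rollback i)

/-- All concretisations of a symbolic trace by valuations that satisfy its path condition. -/
def concTrace (t : STrace L) : Set (Trace L) :=
  {u | ∃ μ : Valuation L, (∀ φ, SObs.cond φ ∈ t → φ.Holds μ) ∧ u = t.filterMap (SObs.conc μ)}

def concSet (B : Set (STrace L)) : Set (Trace L) := {u | ∃ t ∈ B, u ∈ concTrace t}

/-- Symbolic configurations. The program counter is always concrete: `reg pc = val v`. -/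
structure SConfig (L : Lang) where
  mem : SMem L
  reg : Reg L → SExpr L

def Expr.seval (a : Reg L → SExpr L) : Expr L → SExpr L
  | .val v => .val v
  | .reg x => a x
  | .un o e => .un o (e.seval a)
  | .bin o e₁ e₂ => .bin o (e₁.seval a) (e₂.seval a)

/-- The symbolic non-speculative step relation of a program. Targets of jumps and returns are
made concrete, at the price of a path condition. -/
inductive SNSStep (p : Program L) : SConfig L → STrace L → SConfig L → Prop where
  | skip {m : SMem L} {a : Reg L → SExpr L} {n : ℕ} :
      a .pc = .val (some n) → p.code n = some .skip →
      SNSStep p ⟨m, a⟩ [] ⟨m, setReg a .pc (.val (some (n + 1)))⟩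
  | barrier {m : SMem L} {a : Reg L → SExpr L} {n : ℕ} :
      a .pc = .val (some n) → p.code n = some .barrier →
      SNSStep p ⟨m, a⟩ [] ⟨m, setReg a .pc (.val (some (n + 1)))⟩
  | assign {m : SMem L} {a : Reg L → SExpr L} {n : ℕ} {x : Reg L} {e : Expr L} :
      a .pc = .val (some n) → p.code n = some (.assign x e) → x ≠ .pc →
      SNSStep p ⟨m, a⟩ [] ⟨m, setReg (setReg a x (e.seval a)) .pc (.val (some (n + 1)))⟩
  | cmov {m : SMem L} {a : Reg L → SExpr L} {n : ℕ} {x : Reg L} {e c : Expr L} :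
      a .pc = .val (some n) → p.code n = some (.cmov x e c) → x ≠ .pc →
      SNSStep p ⟨m, a⟩ []
        ⟨m, setReg (setReg a x (.ite (c.seval a) (e.seval a) (a x))) .pc (.val (some (n + 1)))⟩
  | load {m : SMem L} {a : Reg L → SExpr L} {n : ℕ} {x : Reg L} {e : Expr L} :
      a .pc = .val (some n) → p.code n = some (.load x e) → x ≠ .pc →
      SNSStep p ⟨m, a⟩ [.load (e.seval a)]
        ⟨m, setReg (setReg a x (.read m (e.seval a))) .pc (.val (some (n + 1)))⟩
  | store {m : SMem L} {a : Reg L → SExpr L} {n : ℕ} {x : Reg L} {e : Expr L} :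
      a .pc = .val (some n) → p.code n = some (.store x e) →
      SNSStep p ⟨m, a⟩ [.store (e.seval a)]
        ⟨.write m (e.seval a) (a x), setReg a .pc (.val (some (n + 1)))⟩
  | jmp {m : SMem L} {a : Reg L → SExpr L} {n : ℕ} {e : Expr L} (l : Val) :
      a .pc = .val (some n) → p.code n = some (.jmp e) →
      SNSStep p ⟨m, a⟩ [.cond (.eq (e.seval a) l), .pc l] ⟨m, setReg a .pc (.val l)⟩
  | beqzSat {m : SMem L} {a : Reg L → SExpr L} {n : ℕ} {x : Reg L} {l : Val} :
      a .pc = .val (some n) → p.code n = some (.beqz x l) →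
      SNSStep p ⟨m, a⟩ [.cond (.eq (a x) (some 0)), .pc l] ⟨m, setReg a .pc (.val l)⟩
  | beqzUnsat {m : SMem L} {a : Reg L → SExpr L} {n : ℕ} {x : Reg L} {l : Val} :
      a .pc = .val (some n) → p.code n = some (.beqz x l) →
      SNSStep p ⟨m, a⟩ [.cond (.ne (a x) (some 0)), .pc (some (n + 1))]
        ⟨m, setReg a .pc (.val (some (n + 1)))⟩
  | call {m : SMem L} {a : Reg L → SExpr L} {n k : ℕ} {f : L.Func} :
      a .pc = .val (some n) → p.code n = some (.call f) → p.funs f = some k →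
      SNSStep p ⟨m, a⟩ [.call f]
        ⟨.write m (.sub8 (a .sp)) (.val (some (n + 1))),
          setReg (setReg a .sp (.sub8 (a .sp))) .pc (.val (some k))⟩
  | ret {m : SMem L} {a : Reg L → SExpr L} {n : ℕ} (l : Val) :
      a .pc = .val (some n) → p.code n = some .ret →
      SNSStep p ⟨m, a⟩ [.cond (.eq (.read m (a .sp)) l), .ret l]
        ⟨m, setReg (setReg a .sp (.add8 (a .sp))) .pc (.val l)⟩
  | terminate {m : SMem L} {a : Reg L → SExpr L} {n : ℕ} :
      a .pc = .val (some n) → p.code n = none →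
      SNSStep p ⟨m, a⟩ [.pc none] ⟨m, setReg a .pc (.val none)⟩

def SStuck (p : Program L) (σ : SConfig L) : Prop := ¬ ∃ t σ', SNSStep p σ t σ'

/-- The initial symbolic configuration: the program counter is the entry point, every other
register and the memory hold their symbols. -/
noncomputable def SConfig.init (p : Program L) : SConfig L :=
  ⟨.sym, setReg SExpr.sym .pc (.val (some p.entry))⟩

def SConfig.Final (σ : SConfig L) : Prop := σ.reg .pc = .val none

/-! ### Always-mispredict semantics for speculation over returns -/

/-- A speculative instance: the transaction counter, the configuration, the return stack buffer
(head = top) and the remaining speculation window. The window is `⊤` when no speculation is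
happening; `⊤ = ⊤ + 1` and `min ω ⊤ = ω` give the intended arithmetic. -/
structure Inst (L : Lang) where
  ctr : ℕ
  conf : Config L
  rsb : List ℕ
  win : ℕ∞

/-- The always-mispredict step relation, for the maximal speculation window `ω` and the maximal
size `N` of the return stack buffer. States are stacks of instances (head = top). -/
inductive AMStep (ω N : ℕ) (p : Program L) : List (Inst L) → Trace L → List (Inst L) → Prop where
  | noSpec {c : ℕ} {σ σ' : Config L} {R : List ℕ} {w n : ℕ∞} {t : Trace L} {S : List (Inst L)} :
      w = n + 1 → NSStep p σ t σ' →
      p.instrAt (σ.reg .pc) ≠ some .barrier → p.instrAt (σ.reg .pc) ≠ some .ret →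
      (∀ f, p.instrAt (σ.reg .pc) ≠ some (.call f)) →
      AMStep ω N p (⟨c, σ, R, w⟩ :: S) t (⟨c, σ', R, n⟩ :: S)
  | barrier {c : ℕ} {σ σ' : Config L} {R : List ℕ} {t : Trace L} {S : List (Inst L)} :
      NSStep p σ t σ' → p.instrAt (σ.reg .pc) = some .barrier →
      AMStep ω N p (⟨c, σ, R, ⊤⟩ :: S) t (⟨c, σ', R, ⊤⟩ :: S)
  | barrierSpec {c : ℕ} {σ σ' : Config L} {R : List ℕ} {w : ℕ∞} {t : Trace L}
      {S : List (Inst L)} :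
      w ≠ 0 → w ≠ ⊤ → NSStep p σ t σ' → p.instrAt (σ.reg .pc) = some .barrier →
      AMStep ω N p (⟨c, σ, R, w⟩ :: S) t (⟨c, σ', R, 0⟩ :: S)
  | call {c k : ℕ} {f : L.Func} {σ σ' : Config L} {R : List ℕ} {w n : ℕ∞} {t : Trace L}
      {S : List (Inst L)} :
      w = n + 1 → NSStep p σ t σ' →
      σ.reg .pc = some k → p.instrAt (σ.reg .pc) = some (.call f) → R.length < N →
      AMStep ω N p (⟨c, σ, R, w⟩ :: S) t (⟨c, σ', (k + 1) :: R, n⟩ :: S)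
  | callFull {c : ℕ} {f : L.Func} {σ σ' : Config L} {R : List ℕ} {w n : ℕ∞} {t : Trace L}
      {S : List (Inst L)} :
      w = n + 1 → NSStep p σ t σ' →
      p.instrAt (σ.reg .pc) = some (.call f) → N ≤ R.length →
      AMStep ω N p (⟨c, σ, R, w⟩ :: S) t (⟨c, σ', R, n⟩ :: S)
  | retEmpty {c : ℕ} {σ σ' : Config L} {w n : ℕ∞} {t : Trace L} {S : List (Inst L)} :
      w = n + 1 → NSStep p σ t σ' → p.instrAt (σ.reg .pc) = some .ret →
      AMStep ω N p (⟨c, σ, [], w⟩ :: S) t (⟨c, σ', [], n⟩ :: S)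
  | retSame {c l : ℕ} {σ σ' : Config L} {R : List ℕ} {w n : ℕ∞} {t : Trace L}
      {S : List (Inst L)} :
      w = n + 1 → NSStep p σ t σ' → p.instrAt (σ.reg .pc) = some .ret →
      some l = σ.mem.read (σ.reg .sp) →
      AMStep ω N p (⟨c, σ, l :: R, w⟩ :: S) t (⟨c, σ', R, n⟩ :: S)
  | retSpec {c l : ℕ} {σ σ' : Config L} {R : List ℕ} {w n : ℕ∞} {t : Trace L}
      {S : List (Inst L)} :
      w = n + 1 → NSStep p σ t σ' → p.instrAt (σ.reg .pc) = some .ret →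
      some l ≠ σ.mem.read (σ.reg .sp) →
      AMStep ω N p (⟨c, σ, l :: R, w⟩ :: S) (t ++ [.start c, .ret (some l)])
        (⟨c + 1,
          ⟨σ.mem, setReg (setReg σ.reg .sp (Val.add8 (σ.reg .sp))) .pc (some l)⟩,
          R, min (ω : ℕ∞) n⟩ :: ⟨c, σ', R, n⟩ :: S)
  | rollback {c c' : ℕ} {σ σ' : Config L} {R R' : List ℕ} {w w' : ℕ∞} {S : List (Inst L)} :
      w' = 0 ∨ Stuck p σ' →
      AMStep ω N p (⟨c', σ', R', w'⟩ :: ⟨c, σ, R, w⟩ :: S) [.rollback c] (⟨c', σ, R, w⟩ :: S)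

/-- `p` produces the trace `t` from `σ` until termination, in the always-mispredict semantics. -/
def AMTrace (ω N : ℕ) (p : Program L) (σ : Config L) (t : Trace L) : Prop :=
  ∃ I : Inst L, Steps (AMStep ω N p) [⟨0, σ, [], ⊤⟩] t [I] ∧ I.conf.Final

/-! ### Oracle semantics for speculation over returns -/

/-- An entry of the history: the address of a return instruction that met a mismatching return
stack buffer, the identifier of the transaction, and the address where execution continued. -/
structure HistEntry where
  loc : ℕ
  id : ℕ
  target : Val

/-- A prediction oracle: it chooses the size of the speculation window, at most `ω`, from the
program, the history and the address of the return instruction. -/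
structure RetOracle (L : Lang) (ω : ℕ) where
  window : Program L → List HistEntry → ℕ → ℕ
  window_le : ∀ p h k, window p h k ≤ ω

/-- Speculative instances of the oracle semantics also track the history. -/
structure OInst (L : Lang) where
  ctr : ℕ
  conf : Config L
  rsb : List ℕ
  hist : List HistEntry
  win : ℕ∞

/-- One instruction is charged to every instance of the stack (`⊤ - 1 = ⊤`). -/
def decr (S : List (OInst L)) : List (OInst L) := S.map fun I => { I with win := I.win - 1 }

open Classical in
/-- A speculation barrier exhausts the window of every speculative instance. -/
noncomputable def zeroes (S : List (OInst L)) : List (OInst L) :=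
  S.map fun I => { I with win := if I.win = ⊤ then ⊤ else 0 }

/-- All windows of the stack are positive. -/
def Enabled (S : List (OInst L)) : Prop := ∀ I ∈ S, I.win ≠ 0

/-- The step relation of the oracle semantics. If some window of the stack is exhausted, the
topmost such instance is rolled back and the instances above it are deleted. -/
inductive OStep {ω : ℕ} (N : ℕ) (O : RetOracle L ω) (p : Program L) :
    List (OInst L) → Trace L → List (OInst L) → Prop where
  | noSpec {c : ℕ} {σ σ' : Config L} {R : List ℕ} {h : List HistEntry} {w : ℕ∞} {t : Trace L}
      {S : List (OInst L)} :
      Enabled (⟨c, σ, R, h, w⟩ :: S) → NSStep p σ t σ' →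
      p.instrAt (σ.reg .pc) ≠ some .barrier → p.instrAt (σ.reg .pc) ≠ some .ret →
      (∀ f, p.instrAt (σ.reg .pc) ≠ some (.call f)) →
      OStep N O p (⟨c, σ, R, h, w⟩ :: S) t (decr (⟨c, σ', R, h, w⟩ :: S))
  | barrier {c : ℕ} {σ σ' : Config L} {R : List ℕ} {h : List HistEntry} {w : ℕ∞} {t : Trace L}
      {S : List (OInst L)} :
      Enabled (⟨c, σ, R, h, w⟩ :: S) → NSStep p σ t σ' →
      p.instrAt (σ.reg .pc) = some .barrier →
      OStep N O p (⟨c, σ, R, h, w⟩ :: S) t (zeroes (⟨c, σ', R, h, w⟩ :: S))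
  | call {c k : ℕ} {f : L.Func} {σ σ' : Config L} {R : List ℕ} {h : List HistEntry} {w : ℕ∞}
      {t : Trace L} {S : List (OInst L)} :
      Enabled (⟨c, σ, R, h, w⟩ :: S) → NSStep p σ t σ' →
      σ.reg .pc = some k → p.instrAt (σ.reg .pc) = some (.call f) → R.length < N →
      OStep N O p (⟨c, σ, R, h, w⟩ :: S) t (decr (⟨c, σ', (k + 1) :: R, h, w⟩ :: S))
  | callFull {c : ℕ} {f : L.Func} {σ σ' : Config L} {R : List ℕ} {h : List HistEntry} {w : ℕ∞}
      {t : Trace L} {S : List (OInst L)} :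
      Enabled (⟨c, σ, R, h, w⟩ :: S) → NSStep p σ t σ' →
      p.instrAt (σ.reg .pc) = some (.call f) → N ≤ R.length →
      OStep N O p (⟨c, σ, R, h, w⟩ :: S) t (decr (⟨c, σ', R, h, w⟩ :: S))
  | retEmpty {c : ℕ} {σ σ' : Config L} {h : List HistEntry} {w : ℕ∞} {t : Trace L}
      {S : List (OInst L)} :
      Enabled (⟨c, σ, [], h, w⟩ :: S) → NSStep p σ t σ' →
      p.instrAt (σ.reg .pc) = some .ret →
      OStep N O p (⟨c, σ, [], h, w⟩ :: S) t (decr (⟨c, σ', [], h, w⟩ :: S))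
  | retSame {c l : ℕ} {σ σ' : Config L} {R : List ℕ} {h : List HistEntry} {w : ℕ∞} {t : Trace L}
      {S : List (OInst L)} :
      Enabled (⟨c, σ, l :: R, h, w⟩ :: S) → NSStep p σ t σ' →
      p.instrAt (σ.reg .pc) = some .ret → some l = σ.mem.read (σ.reg .sp) →
      OStep N O p (⟨c, σ, l :: R, h, w⟩ :: S) t (decr (⟨c, σ', R, h, w⟩ :: S))
  | retSpec {c k l : ℕ} {σ σ' : Config L} {R : List ℕ} {h : List HistEntry} {w : ℕ∞}
      {t : Trace L} {S : List (OInst L)} :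
      Enabled (⟨c, σ, l :: R, h, w⟩ :: S) → NSStep p σ t σ' → σ.reg .pc = some k →
      p.instrAt (σ.reg .pc) = some .ret → some l ≠ σ.mem.read (σ.reg .sp) →
      OStep N O p (⟨c, σ, l :: R, h, w⟩ :: S) (t ++ [.start c, .ret (some l)])
        (⟨c + 1,
          ⟨σ.mem, setReg (setReg σ.reg .sp (Val.add8 (σ.reg .sp))) .pc (some l)⟩,
          R, h ++ [⟨k, c, some l⟩], (O.window p h k : ℕ∞)⟩ ::
        decr (⟨c, σ', R, h ++ [⟨k, c, σ.mem.read (σ.reg .sp)⟩], w⟩ :: S))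
  | rollback {A S T : List (OInst L)} {I J top : OInst L} :
      A ++ I :: J :: S = top :: T → Enabled A → I.win = 0 →
      OStep N O p (A ++ I :: J :: S) [.rollback J.ctr] ({ J with ctr := top.ctr } :: S)
  | rollbackStuck {I J : OInst L} {S : List (OInst L)} :
      Enabled (I :: J :: S) → Stuck p I.conf →
      OStep N O p (I :: J :: S) [.rollback J.ctr] ({ J with ctr := I.ctr } :: S)

/-- `p` produces the trace `t` from `σ` until termination, in the semantics with oracle `O`. -/
def OTrace {ω : ℕ} (N : ℕ) (O : RetOracle L ω) (p : Program L) (σ : Config L) (t : Trace L) :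
    Prop :=
  ∃ I : OInst L, Steps (OStep N O p) [⟨0, σ, [], [], ⊤⟩] t [I] ∧ I.conf.Final

/-! ### Symbolic (always-mispredict) semantics for speculation over returns -/

structure SInst (L : Lang) where
  ctr : ℕ
  conf : SConfig L
  rsb : List ℕ
  win : ℕ∞

/-- The always-mispredict rules with symbolic configurations and symbolic non-speculative steps.
At a return, the actual return address is the (concrete) program counter after that step. -/
inductive SAMStep (ω N : ℕ) (p : Program L) :
    List (SInst L) → STrace L → List (SInst L) → Prop where
  | noSpec {c : ℕ} {v : Val} {σ σ' : SConfig L} {R : List ℕ} {w n : ℕ∞} {t : STrace L}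
      {S : List (SInst L)} :
      w = n + 1 → SNSStep p σ t σ' → σ.reg .pc = .val v →
      p.instrAt v ≠ some .barrier → p.instrAt v ≠ some .ret →
      (∀ f, p.instrAt v ≠ some (.call f)) →
      SAMStep ω N p (⟨c, σ, R, w⟩ :: S) t (⟨c, σ', R, n⟩ :: S)
  | barrier {c : ℕ} {v : Val} {σ σ' : SConfig L} {R : List ℕ} {t : STrace L}
      {S : List (SInst L)} :
      SNSStep p σ t σ' → σ.reg .pc = .val v → p.instrAt v = some .barrier →
      SAMStep ω N p (⟨c, σ, R, ⊤⟩ :: S) t (⟨c, σ', R, ⊤⟩ :: S)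
  | barrierSpec {c : ℕ} {v : Val} {σ σ' : SConfig L} {R : List ℕ} {w : ℕ∞} {t : STrace L}
      {S : List (SInst L)} :
      w ≠ 0 → w ≠ ⊤ → SNSStep p σ t σ' → σ.reg .pc = .val v → p.instrAt v = some .barrier →
      SAMStep ω N p (⟨c, σ, R, w⟩ :: S) t (⟨c, σ', R, 0⟩ :: S)
  | call {c k : ℕ} {f : L.Func} {σ σ' : SConfig L} {R : List ℕ} {w n : ℕ∞} {t : STrace L}
      {S : List (SInst L)} :
      w = n + 1 → SNSStep p σ t σ' →
      σ.reg .pc = .val (some k) → p.instrAt (some k) = some (.call f) → R.length < N →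
      SAMStep ω N p (⟨c, σ, R, w⟩ :: S) t (⟨c, σ', (k + 1) :: R, n⟩ :: S)
  | callFull {c : ℕ} {v : Val} {f : L.Func} {σ σ' : SConfig L} {R : List ℕ} {w n : ℕ∞}
      {t : STrace L} {S : List (SInst L)} :
      w = n + 1 → SNSStep p σ t σ' →
      σ.reg .pc = .val v → p.instrAt v = some (.call f) → N ≤ R.length →
      SAMStep ω N p (⟨c, σ, R, w⟩ :: S) t (⟨c, σ', R, n⟩ :: S)
  | retEmpty {c : ℕ} {v : Val} {σ σ' : SConfig L} {w n : ℕ∞} {t : STrace L}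
      {S : List (SInst L)} :
      w = n + 1 → SNSStep p σ t σ' → σ.reg .pc = .val v → p.instrAt v = some .ret →
      SAMStep ω N p (⟨c, σ, [], w⟩ :: S) t (⟨c, σ', [], n⟩ :: S)
  | retSame {c l : ℕ} {v : Val} {σ σ' : SConfig L} {R : List ℕ} {w n : ℕ∞} {t : STrace L}
      {S : List (SInst L)} :
      w = n + 1 → SNSStep p σ t σ' → σ.reg .pc = .val v → p.instrAt v = some .ret →
      σ'.reg .pc = .val (some l) →
      SAMStep ω N p (⟨c, σ, l :: R, w⟩ :: S) t (⟨c, σ', R, n⟩ :: S)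
  | retSpec {c l : ℕ} {v : Val} {σ σ' : SConfig L} {R : List ℕ} {w n : ℕ∞} {t : STrace L}
      {S : List (SInst L)} :
      w = n + 1 → SNSStep p σ t σ' → σ.reg .pc = .val v → p.instrAt v = some .ret →
      σ'.reg .pc ≠ .val (some l) →
      SAMStep ω N p (⟨c, σ, l :: R, w⟩ :: S) (t ++ [.start c, .ret (some l)])
        (⟨c + 1,
          ⟨σ.mem, setReg (setReg σ.reg .sp (.add8 (σ.reg .sp))) .pc (.val (some l))⟩,
          R, min (ω : ℕ∞) n⟩ :: ⟨c, σ', R, n⟩ :: S)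
  | rollback {c c' : ℕ} {σ σ' : SConfig L} {R R' : List ℕ} {w w' : ℕ∞} {S : List (SInst L)} :
      w' = 0 ∨ SStuck p σ' →
      SAMStep ω N p (⟨c', σ', R', w'⟩ :: ⟨c, σ, R, w⟩ :: S) [.rollback c] (⟨c', σ, R, w⟩ :: S)

/-- `t` is a symbolic trace of `p` from the initial symbolic configuration until termination. -/
def SAMTrace (ω N : ℕ) (p : Program L) (t : STrace L) : Prop :=
  ∃ I : SInst L, Steps (SAMStep ω N p) [⟨0, SConfig.init p, [], ⊤⟩] t [I] ∧ I.conf.Final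

/-! ### Speculative non-interference and secure speculative semantics -/

/-- A policy lists the public registers and the public memory locations. -/
structure Policy (L : Lang) where
  regs : List (Reg L)
  locs : List ℕ

/-- The two configurations agree on all that the policy declares public. -/
def LowEquiv (P : Policy L) (σ₁ σ₂ : Config L) : Prop :=
  (∀ x ∈ P.regs, σ₁.reg x = σ₂.reg x) ∧ ∀ n ∈ P.locs, σ₁.mem n = σ₂.mem n

/-- Speculative non-interference of `p` for the policy `P`, where `T σ t` says that `p` produces
the (terminated) trace `t` from `σ`. -/
def SNI (P : Policy L) (p : Program L) (T : Config L → Trace L → Prop) : Prop :=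
  ∀ σ₁ σ₂ : Config L, σ₁.Initial p → σ₂.Initial p → LowEquiv P σ₁ σ₂ →
    ∀ t₁ t₂ : Trace L, T σ₁ t₁ → T σ₂ t₂ → nsProj t₁ = nsProj t₂ → t₁ = t₂

/-- A speculative semantics, given by the terminated traces of its three components: the
always-mispredict, the oracle and the symbolic semantics. -/
structure SpecSem (L : Lang) where
  Oracle : Type
  am : Program L → Config L → Trace L → Prop
  orc : Oracle → Program L → Config L → Trace L → Prop
  symb : Program L → STrace L → Prop

/-- Behaviour under the always-mispredict semantics. -/
def SpecSem.beh (X : SpecSem L) (p : Program L) : Set (Trace L) :=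
  {t | ∃ σ, σ.Initial p ∧ X.am p σ t}

/-- Behaviour under the oracle semantics. -/
def SpecSem.behO (X : SpecSem L) (O : X.Oracle) (p : Program L) : Set (Trace L) :=
  {t | ∃ σ, σ.Initial p ∧ X.orc O p σ t}

/-- Behaviour under the symbolic semantics. -/
def SpecSem.behSymb (X : SpecSem L) (p : Program L) : Set (STrace L) := {t | X.symb p t}

/-- Secure speculative semantics. -/
structure SpecSem.IsSSS (X : SpecSem L) : Prop where
  oracle_overapprox : ∀ (P : Policy L) (p : Program L),
    (∀ O : X.Oracle, SNI P p (X.orc O p)) ↔ SNI P p (X.am p)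
  symbolic_consistency : ∀ p : Program L, X.beh p = concSet (X.behSymb p)
  ns_consistency : ∀ p : Program L,
    nsProj '' X.beh p = behNS p ∧ ∀ O : X.Oracle, nsProj '' X.behO O p = behNS p

/-- The semantics for speculation over returns, with maximal speculation window `ω` and an
acyclic return stack buffer of size at most `N`. -/
def specR (L : Lang) (ω N : ℕ) : SpecSem L where
  Oracle := RetOracle L ω
  am := AMTrace ω N
  orc := OTrace N
  symb := SAMTrace ω N

end MuAsm

namespace MuAsm

variable {L : Lang} {ω N : ℕ} {p : Program L}

/-! ### The non-speculative semantics -/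

-- Both concrete speculative semantics are brought into the form of one deterministic step relation
-- `GStep`, whose mode is an oracle or, for always-mispredict, `none`. For oracles this only
-- reorganises the rules (`oTrace_iff`). For always-mispredict it rests on an invariant: windows
-- never increase towards the top of the stack (`WinMono`), so a positive top window makes all
-- windows positive (`amTrace_iff`).
--
-- Non-speculative consistency. Instances above the base have finite windows and larger counters
-- than the base. Hence the first rollback with the counter of the base is the one that ends the
-- speculation, and the projection of a run is a non-speculative trace (`GRun.nsProjAux`).
-- Conversely, a weight exponential in the least window of the stack decreases with every
-- speculative step. Speculation therefore ends, and every terminating non-speculative run extends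
-- to a terminating run in every mode (`NSTrace.exists_nsProj_eq`).
--
-- Oracle over-approximation. A path is a list of decisions, one per misprediction: follow the
-- prediction or the actual return. `PairReach` describes, without reference to a mode, the pairs of
-- configurations met along a path under always-mispredict windows; `PathsAgree` says that their
-- observations agree. Agreement yields equal traces in every mode, because no mode grants more
-- steps than the path does (`PathsAgree.eq_of_gRun`). Equal always-mispredict traces yield
-- agreement, because that semantics visits all paths (`pathsAgree_of_pairRun`). Equal traces under
-- all oracles yield it too, because each path is followed by the oracle that answers `ω` or `0` as
-- the path decides (`pathsAgree_of_pairRun_oracle`). Modes are exchanged in `sni_of_sni`: by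
-- non-speculative consistency, two runs with equal projections have counterparts in any other mode,
-- with the same projections.
--
-- Symbolic consistency. Program counters and buffers of symbolic states are concrete, so a symbolic
-- run whose path conditions hold evaluates step by step to a concrete run. Conversely, a concrete
-- run dictates the branches and targets that the symbolic run has to choose.

abbrev Config.pcv (σ : Config L) : Val := σ.reg .pc

theorem setReg_same {α : Type} (a : Reg L → α) (x : Reg L) (v : α) : setReg a x v x = v := by
  simp [setReg]

theorem setReg_of_ne {α : Type} (a : Reg L → α) {x y : Reg L} (v : α) (h : y ≠ x) :
    setReg a x v y = a y := by
  simp [setReg, h]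

theorem NSStep.det {σ σ₁ σ₂ : Config L} {t₁ t₂ : Trace L} (h₁ : NSStep p σ t₁ σ₁)
    (h₂ : NSStep p σ t₂ σ₂) : t₁ = t₂ ∧ σ₁ = σ₂ := by
  cases h₁ <;> cases h₂ <;> simp_all

/-- The program counter after a step, in terms of the old one and the observation. -/
def pcAfter (p : Program L) (v : Val) : Trace L → Val
  | [.pc l] => l
  | [.ret l] => l
  | [.call f] => p.funs f
  | _ => v.map (· + 1)

/-- Jumps, branches and returns reveal their target, and the other instructions have a target fixed
by the program. Equal observations at equal program counters thus keep two runs in lockstep. -/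
theorem NSStep.pc_eq {σ σ' : Config L} {t : Trace L} (h : NSStep p σ t σ') :
    σ'.pcv = pcAfter p σ.pcv t := by
  cases h <;> simp_all [pcAfter, Config.pcv, setReg_same]

/-- The number of observations of an instruction. -/
def obsCount : Option (Instr L) → ℕ
  | some .skip | some .barrier | some (.assign _ _) | some (.cmov _ _ _) => 0
  | _ => 1

/-- The data never influence how many observations are made. This allows two equal traces to be cut
at the same place after a step of each run. -/
theorem NSStep.length_eq {σ σ' : Config L} {t : Trace L} (h : NSStep p σ t σ') :
    t.length = obsCount (p.instrAt σ.pcv) := by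
  cases h <;> simp_all [obsCount, Config.pcv, Program.instrAt]

theorem NSStep.not_spec {σ σ' : Config L} {t : Trace L} (h : NSStep p σ t σ') (i : ℕ) :
    Obs.start i ∉ t ∧ Obs.rollback i ∉ t := by
  cases h <;> simp

theorem NSStep.not_final {σ σ' : Config L} {t : Trace L} (h : NSStep p σ t σ') :
    ¬ σ.Final := by
  cases h <;> simp_all [Config.Final]

/-- Data only select between the two rules of a conditional instruction, one of which always
applies; whether a step exists is a matter of control alone. -/
theorem NSStep.exists_of_pc_eq {σ₁ σ₂ σ₁' : Config L} {t₁ : Trace L} (h : NSStep p σ₁ t₁ σ₁')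
    (e : σ₁.pcv = σ₂.pcv) : ∃ t₂ σ₂', NSStep p σ₂ t₂ σ₂' := by
  obtain ⟨m, a⟩ := σ₂
  cases h with
  | skip h₁ h₂ => exact ⟨_, _, .skip (e.symm.trans h₁) h₂⟩
  | barrier h₁ h₂ => exact ⟨_, _, .barrier (e.symm.trans h₁) h₂⟩
  | assign h₁ h₂ h₃ => exact ⟨_, _, .assign (e.symm.trans h₁) h₂ h₃⟩
  | @cmovSat _ _ _ _ _ c h₁ h₂ h₃ _ | @cmovUnsat _ _ _ _ _ c h₁ h₂ h₃ _ =>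
    by_cases h : c.eval a = some 0
    · exact ⟨_, _, .cmovSat (e.symm.trans h₁) h₂ h₃ h⟩
    · exact ⟨_, _, .cmovUnsat (e.symm.trans h₁) h₂ h₃ h⟩
  | load h₁ h₂ h₃ => exact ⟨_, _, .load (e.symm.trans h₁) h₂ h₃⟩
  | store h₁ h₂ => exact ⟨_, _, .store (e.symm.trans h₁) h₂⟩
  | jmp h₁ h₂ => exact ⟨_, _, .jmp (e.symm.trans h₁) h₂⟩
  | @beqzSat _ _ _ x _ h₁ h₂ _ | @beqzUnsat _ _ _ x _ h₁ h₂ _ =>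
    by_cases h : a x = some 0
    · exact ⟨_, _, .beqzSat (e.symm.trans h₁) h₂ h⟩
    · exact ⟨_, _, .beqzUnsat (e.symm.trans h₁) h₂ h⟩
  | call h₁ h₂ h₃ => exact ⟨_, _, .call (e.symm.trans h₁) h₂ h₃⟩
  | ret h₁ h₂ => exact ⟨_, _, .ret (e.symm.trans h₁) h₂⟩
  | terminate h₁ h₂ => exact ⟨_, _, .terminate (e.symm.trans h₁) h₂⟩

theorem Stuck.of_pc_eq {σ₁ σ₂ : Config L} (h : Stuck p σ₁) (e : σ₁.pcv = σ₂.pcv) :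
    Stuck p σ₂ :=
  fun ⟨_, _, h'⟩ => h (h'.exists_of_pc_eq e.symm)

theorem NSStep.pc_of_ret {σ σ' : Config L} {t : Trace L} (h : NSStep p σ t σ')
    (hr : p.instrAt σ.pcv = some .ret) : σ'.pcv = σ.mem.read (σ.reg .sp) := by
  cases h <;> simp_all [Config.pcv, Program.instrAt, setReg_same]

theorem NSStep.exists_pc {σ σ' : Config L} {t : Trace L} (h : NSStep p σ t σ') :
    ∃ k, σ.pcv = some k := by
  cases h <;> exact ⟨_, by assumption⟩

theorem NSTrace.head {σ σ' : Config L} {t u : Trace L} (h : NSStep p σ t σ')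
    (h' : NSTrace p σ' u) : NSTrace p σ (t ++ u) :=
  let ⟨σ'', hs, hf⟩ := h'
  ⟨σ'', .head h hs, hf⟩

theorem NSTrace.det {σ : Config L} {t₁ t₂ : Trace L} (h₁ : NSTrace p σ t₁)
    (h₂ : NSTrace p σ t₂) : t₁ = t₂ := by
  obtain ⟨σ₁, s₁, f₁⟩ := h₁
  induction s₁ generalizing t₂ with
  | refl =>
    obtain ⟨σ₂, s₂, f₂⟩ := h₂
    cases s₂ with
    | refl => rfl
    | head h _ => exact (h.not_final f₁).elim
  | head h _ ih =>
    obtain ⟨σ₂, s₂, f₂⟩ := h₂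
    cases s₂ with
    | refl => exact (h.not_final f₂).elim
    | head h' s' =>
      obtain ⟨rfl, rfl⟩ := h.det h'
      rw [ih ⟨_, s', f₂⟩ f₁]

-- Concatenation of runs and the scan of the projection

theorem Steps.trans {S E : Type} {step : S → List E → S → Prop} {s s' s'' : S} {t t' : List E}
    (h : Steps step s t s') (h' : Steps step s' t' s'') : Steps step s (t ++ t') s'' := by
  induction h with
  | refl => exact h'
  | head h _ ih => rw [List.append_assoc]; exact .head h (ih h')

theorem nsProjAux_none_append {t : Trace L} (h : ∀ i, Obs.start i ∉ t) (u : Trace L) :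
    nsProjAux none (t ++ u) = t ++ nsProjAux none u := by
  induction t with
  | nil => rfl
  | cons o t ih =>
    have := ih fun i hi => h i (List.mem_cons_of_mem _ hi)
    cases o with
    | start i => exact absurd List.mem_cons_self (h i)
    | _ => simp_all [nsProjAux]

theorem nsProjAux_some_append {t : Trace L} {i : ℕ} (h : Obs.rollback i ∉ t) (u : Trace L) :
    nsProjAux (some i) (t ++ u) = nsProjAux (some i) u := by
  induction t with
  | nil => rfl
  | cons o t ih =>
    have := ih fun hi => h (List.mem_cons_of_mem _ hi)
    cases o <;> simp_all [nsProjAux]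
    intro h'; simp_all

/-! ### Windows, return stack buffer and predictions as functions of the program counter -/

open Classical in
/-- The charge of an instruction at `v` to a speculation window. -/
noncomputable def tick (p : Program L) (v : Val) (w : ℕ∞) : ℕ∞ :=
  if p.instrAt v = some .barrier then (if w = ⊤ then ⊤ else 0) else w - 1

/-- The return stack buffer after the instruction at `v`. -/
def rsbNext (N : ℕ) (p : Program L) (v : Val) (R : List ℕ) : List ℕ :=
  match p.instrAt v with
  | some (.call _) => if R.length < N then (v.getD 0 + 1) :: R else R
  | some .ret => R.tail
  | _ => R

/-- The wrong prediction of the return stack buffer for the instruction at `v`, if execution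
continues at `v'`. -/
def mispredicted (p : Program L) (v v' : Val) (R : List ℕ) : Option ℕ :=
  match p.instrAt v with
  | some .ret => R.head?.filter fun l => some l ≠ v'
  | _ => none

/-- The configuration in which a return continues at the predicted address. -/
noncomputable def Config.predict (σ : Config L) (l : ℕ) : Config L :=
  ⟨σ.mem, setReg (setReg σ.reg .sp (Val.add8 (σ.reg .sp))) .pc (some l)⟩

/-- The observations that start a transaction. -/
def specObs (c : ℕ) : Option ℕ → Trace L
  | none => []
  | some l => [.start c, .ret (some l)]

theorem tick_top (v : Val) : tick p v ⊤ = ⊤ := by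
  simp [tick]

theorem tick_le_pred (v : Val) (w : ℕ∞) : tick p v w ≤ w - 1 := by
  unfold tick; split_ifs <;> simp_all

theorem tick_le (v : Val) (w : ℕ∞) : tick p v w ≤ w :=
  (tick_le_pred v w).trans tsub_le_self

theorem tick_eq_top {v : Val} {w : ℕ∞} : tick p v w = ⊤ ↔ w = ⊤ := by
  refine ⟨fun h => ?_, by rintro rfl; exact tick_top v⟩
  exact top_le_iff.1 (h ▸ tick_le v w)

theorem tick_mono (v : Val) : Monotone (tick p v) := by
  intro a b h
  unfold tick
  split_ifs
  · simp
  · simp_all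
  · simp
  · simp
  · exact tsub_le_tsub_right h 1

theorem tick_lt {v : Val} {w : ℕ∞} (h : w ≠ 0) (h' : w ≠ ⊤) : tick p v w < w := by
  refine (tick_le_pred v w).trans_lt ?_
  lift w to ℕ using h'
  norm_cast at *
  omega

theorem tick_of_not_barrier {v : Val} (h : p.instrAt v ≠ some .barrier) (w : ℕ∞) :
    tick p v w = w - 1 := by
  simp [tick, h]

theorem ENat.exists_eq_add_one {w : ℕ∞} (h : w ≠ 0) : w = (w - 1) + 1 := by
  rw [tsub_add_cancel_of_le (Order.one_le_iff_pos.2 (pos_iff_ne_zero.2 h))]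

theorem ENat.add_one_sub_one (n : ℕ∞) : n + 1 - 1 = n := by
  cases n <;> norm_cast

/-! ### A common deterministic presentation of the two speculative semantics -/

/-- The window of an instance below the top, after an instruction at `v`. The mode is an oracle,
or `none` for the always-mispredict semantics. -/
noncomputable def lowerWin (M : Option (RetOracle L ω)) (p : Program L) (v : Val) (w : ℕ∞) : ℕ∞ :=
  match M with
  | none => w
  | some _ => tick p v w

/-- The window of a new instance, from the history, the address of the return and the remaining
window of the instance that speculates. -/
noncomputable def newWin (M : Option (RetOracle L ω)) (p : Program L) (h : List HistEntry) (k : ℕ) (w : ℕ∞) :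
    ℕ∞ :=
  match M with
  | none => min (ω : ℕ∞) w
  | some O => O.window p h k

noncomputable def lowerInst (M : Option (RetOracle L ω)) (p : Program L) (v : Val) (I : OInst L) :
    OInst L :=
  { I with win := lowerWin M p v I.win }

/-- Covers all rules except rollbacks: a return with an empty or a correct buffer is the case
without misprediction. The default in `getD 0` never matters, since a step requires a numeric
program counter. -/
noncomputable def nextStack (M : Option (RetOracle L ω)) (N : ℕ) (p : Program L) (I : OInst L)
    (σ' : Config L) (S : List (OInst L)) : List (OInst L) :=
  match mispredicted p I.conf.pcv σ'.pcv I.rsb with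
  | none => ⟨I.ctr, σ', rsbNext N p I.conf.pcv I.rsb, I.hist, tick p I.conf.pcv I.win⟩ ::
      S.map (lowerInst M p I.conf.pcv)
  | some l =>
      ⟨I.ctr + 1, I.conf.predict l, rsbNext N p I.conf.pcv I.rsb,
        I.hist ++ [⟨I.conf.pcv.getD 0, I.ctr, some l⟩],
        newWin M p I.hist (I.conf.pcv.getD 0) (tick p I.conf.pcv I.win)⟩ ::
      ⟨I.ctr, σ', rsbNext N p I.conf.pcv I.rsb,
        I.hist ++ [⟨I.conf.pcv.getD 0, I.ctr, σ'.pcv⟩], tick p I.conf.pcv I.win⟩ ::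
      S.map (lowerInst M p I.conf.pcv)

open Classical in
/-- Roll back the topmost instance with window `0`; the instance below gets the counter `c`. -/
noncomputable def popZero (c : ℕ) : List (OInst L) → Option (Obs L × List (OInst L))
  | I :: J :: S =>
    if I.win = 0 then some (.rollback J.ctr, { J with ctr := c } :: S) else popZero c (J :: S)
  | _ => none

/-- Histories are kept in every mode, although only oracles read them. The whole stack must be
enabled even in the always-mispredict mode, which costs nothing on stacks satisfying `WinMono`. -/
inductive GStep (M : Option (RetOracle L ω)) (N : ℕ) (p : Program L) :
    List (OInst L) → Trace L → List (OInst L) → Prop where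
  | step {I : OInst L} {S : List (OInst L)} {t : Trace L} {σ' : Config L} :
      Enabled (I :: S) → NSStep p I.conf t σ' →
      GStep M N p (I :: S) (t ++ specObs I.ctr (mispredicted p I.conf.pcv σ'.pcv I.rsb))
        (nextStack M N p I σ' S)
  | rollback {I : OInst L} {S S' : List (OInst L)} {o : Obs L} :
      popZero I.ctr (I :: S) = some (o, S') → GStep M N p (I :: S) [o] S'
  | stuck {I J : OInst L} {S : List (OInst L)} :
      Enabled (I :: J :: S) → Stuck p I.conf →
      GStep M N p (I :: J :: S) [.rollback J.ctr] ({ J with ctr := I.ctr } :: S)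

/-- `t` is the trace of a terminating run from the stack `S`. -/
def GRun (M : Option (RetOracle L ω)) (N : ℕ) (p : Program L) (S : List (OInst L))
    (t : Trace L) : Prop :=
  ∃ I : OInst L, Steps (GStep M N p) S t [I] ∧ I.conf.Final

variable {M : Option (RetOracle L ω)}

theorem lowerWin_top (v : Val) : lowerWin M p v ⊤ = ⊤ := by
  cases M <;> simp [lowerWin, tick_top]

theorem lowerWin_le (v : Val) (w : ℕ∞) : lowerWin M p v w ≤ w := by
  cases M <;> simp [lowerWin, tick_le]

theorem lowerWin_eq_top {v : Val} {w : ℕ∞} : lowerWin M p v w = ⊤ ↔ w = ⊤ := by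
  cases M <;> simp [lowerWin, tick_eq_top]

theorem lowerWin_mono (v : Val) : Monotone (lowerWin M p v) := by
  cases M
  · exact monotone_id
  · exact tick_mono v

theorem newWin_ne_top (h : List HistEntry) (k : ℕ) (w : ℕ∞) : newWin M p h k w ≠ ⊤ := by
  cases M <;> simp [newWin]

theorem enabled_cons {I : OInst L} {S : List (OInst L)} :
    Enabled (I :: S) ↔ I.win ≠ 0 ∧ Enabled S := by
  simp [Enabled]

theorem not_enabled_of_popZero {c : ℕ} {S : List (OInst L)} {r : Obs L × List (OInst L)}
    (h : popZero c S = some r) : ¬ Enabled S := by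
  induction S with
  | nil => simp [popZero] at h
  | cons I S ih =>
    rw [enabled_cons]
    cases S with
    | nil => simp [popZero] at h
    | cons J S =>
      rw [popZero] at h
      split_ifs at h with h'
      · exact fun h'' => h''.1 h'
      · exact fun h'' => ih h h''.2

theorem popZero_append {c : ℕ} {A S : List (OInst L)} {I J : OInst L} (hA : Enabled A)
    (hI : I.win = 0) :
    popZero c (A ++ I :: J :: S) = some (.rollback J.ctr, { J with ctr := c } :: S) := by
  induction A with
  | nil => simp [popZero, hI]
  | cons K A ih =>
    rw [enabled_cons] at hA
    have := ih hA.2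
    cases A <;> simp_all [popZero]

/-- With `popZero_append`, this matches the recursive function with the decomposition of the stack
in `OStep.rollback`. -/
theorem exists_of_popZero {c : ℕ} {S : List (OInst L)} {r : Obs L × List (OInst L)}
    (h : popZero c S = some r) : ∃ A I J S', S = A ++ I :: J :: S' ∧ Enabled A ∧ I.win = 0 ∧
      r = (.rollback J.ctr, { J with ctr := c } :: S') := by
  induction S with
  | nil => simp [popZero] at h
  | cons I S ih =>
    cases S with
    | nil => simp [popZero] at h
    | cons J S =>
      rw [popZero] at h
      split_ifs at h with h'
      · exact ⟨[], I, J, S, rfl, by simp [Enabled], h', (Option.some.inj h).symm⟩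
      · obtain ⟨A, I', J', S', e, hA, hI, hr⟩ := ih h
        exact ⟨I :: A, I', J', S', by rw [e]; rfl, enabled_cons.2 ⟨h', hA⟩, hI, hr⟩

/-- The three rules exclude one another: `popZero` succeeds only if some window is zero, and a stuck
configuration has no step. -/
theorem GStep.det {S S₁ S₂ : List (OInst L)} {t₁ t₂ : Trace L} (h₁ : GStep M N p S t₁ S₁)
    (h₂ : GStep M N p S t₂ S₂) : t₁ = t₂ ∧ S₁ = S₂ := by
  cases h₁ with
  | step e s =>
    cases h₂ with
    | step _ s' => obtain ⟨rfl, rfl⟩ := s.det s'; exact ⟨rfl, rfl⟩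
    | rollback h => exact (not_enabled_of_popZero h e).elim
    | stuck _ h => exact (h ⟨_, _, s⟩).elim
  | rollback h =>
    cases h₂ with
    | step e _ => exact (not_enabled_of_popZero h e).elim
    | rollback h' => simp_all
    | stuck e _ => exact (not_enabled_of_popZero h e).elim
  | stuck e h =>
    cases h₂ with
    | step _ s => exact (h ⟨_, _, s⟩).elim
    | rollback h => exact (not_enabled_of_popZero h e).elim
    | stuck _ _ => exact ⟨rfl, rfl⟩

theorem GStep.not_final {I : OInst L} {t : Trace L} {S : List (OInst L)}
    (h : GStep M N p [I] t S) : ¬ I.conf.Final := by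
  cases h with
  | step _ s => exact s.not_final
  | rollback h => simp [popZero] at h

/-- By determinism a terminating run has to begin with any step that is possible; a final single
instance has none. -/
theorem GRun.of_step {S S' : List (OInst L)} {t u : Trace L} (h : GStep M N p S t S')
    (r : GRun M N p S u) : ∃ u', u = t ++ u' ∧ GRun M N p S' u' := by
  obtain ⟨I, s, f⟩ := r
  cases s with
  | refl => exact (h.not_final f).elim
  | head h' s =>
    obtain ⟨rfl, rfl⟩ := h.det h'
    exact ⟨_, rfl, I, s, f⟩

theorem GRun.head {S S' : List (OInst L)} {t u : Trace L} (h : GStep M N p S t S')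
    (r : GRun M N p S' u) : GRun M N p S (t ++ u) :=
  let ⟨I, s, f⟩ := r
  ⟨I, .head h s, f⟩

theorem GRun.trans {S S' : List (OInst L)} {t u : Trace L} (h : Steps (GStep M N p) S t S')
    (r : GRun M N p S' u) : GRun M N p S (t ++ u) :=
  let ⟨I, s, f⟩ := r
  ⟨I, h.trans s, f⟩

theorem GRun.induction {P : List (OInst L) → Trace L → Prop}
    (final : ∀ I : OInst L, I.conf.Final → P [I] [])
    (head : ∀ S t S' u, GStep M N p S t S' → GRun M N p S' u → P S' u → P S (t ++ u))
    {S : List (OInst L)} {t : Trace L} (h : GRun M N p S t) : P S t := by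
  obtain ⟨I, s, f⟩ := h
  generalize hE : [I] = E at s
  induction s with
  | refl => subst hE; exact final I f
  | head h s ih => subst hE; exact head _ _ _ _ h ⟨I, s, f⟩ (ih rfl)

theorem GRun.det {S : List (OInst L)} {t u : Trace L} (h : GRun M N p S t)
    (h' : GRun M N p S u) : t = u := by
  refine GRun.induction (P := fun S t => ∀ u, GRun M N p S u → t = u) ?_ ?_ h u h'
  · rintro I f u ⟨J, s, _⟩
    cases s with
    | refl => rfl
    | head s _ => exact (s.not_final f).elim
  · intro S t S' _ s _ ih u r
    obtain ⟨u', rfl, r'⟩ := r.of_step s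
    rw [ih _ r']

/-! ### Budgets -/

/-- The least window of a stack. -/
noncomputable def budget : List (OInst L) → ℕ∞
  | [] => ⊤
  | I :: S => min I.win (budget S)

/-- Windows do not increase towards the top. -/
def WinMono : List (OInst L) → Prop
  | [] => True
  | I :: S => I.win ≤ budget S ∧ WinMono S

/-- In the always-mispredict semantics, windows do not increase towards the top. -/
def WellFormed (M : Option (RetOracle L ω)) (S : List (OInst L)) : Prop := M = none → WinMono S

theorem enabled_iff {S : List (OInst L)} : Enabled S ↔ budget S ≠ 0 := by
  induction S with
  | nil => simp [Enabled, budget]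
  | cons I S ih => rw [enabled_cons, ih, budget]; simp only [← pos_iff_ne_zero, lt_min_iff]

theorem budget_lower (v : Val) (S : List (OInst L)) :
    budget (S.map (lowerInst M p v)) = lowerWin M p v (budget S) := by
  induction S with
  | nil => simp [budget, lowerWin_top]
  | cons I S ih => simp [budget, ih, lowerInst, (lowerWin_mono v).map_min]

theorem map_lowerInst_none (v : Val) (S : List (OInst L)) :
    S.map (lowerInst (none : Option (RetOracle L ω)) p v) = S := by
  exact List.map_id' S

theorem WellFormed.tail {I : OInst L} {S : List (OInst L)} (h : WellFormed M (I :: S)) :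
    WellFormed M S := fun e => (h e).2

/-- The reasons differ by mode: an oracle run charges every window, and `tick` commutes with minima;
an always-mispredict run charges only the top, but the top is the minimum before and after. -/
theorem WellFormed.budget_next {I : OInst L} {S : List (OInst L)} (h : WellFormed M (I :: S))
    (v : Val) :
    min (tick p v I.win) (budget (S.map (lowerInst M p v))) = tick p v (budget (I :: S)) := by
  cases M with
  | none =>
    have := (h rfl).1
    rw [map_lowerInst_none, budget, min_eq_left this, min_eq_left ((tick_le _ _).trans this)]
  | some O => rw [budget_lower, budget, (tick_mono v).map_min]; rfl

theorem popZero_wellFormed {c : ℕ} {S S' : List (OInst L)} {o : Obs L}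
    (h : popZero c S = some (o, S')) (hS : WellFormed M S) : WellFormed M S' := by
  induction S with
  | nil => simp [popZero] at h
  | cons I S ih =>
    cases S with
    | nil => simp [popZero] at h
    | cons J S =>
      rw [popZero] at h
      split_ifs at h with h'
      · simp only [Option.some.injEq, Prod.mk.injEq] at h
        rw [← h.2]
        exact fun e => (hS e).2
      · exact ih h hS.tail

theorem GStep.wellFormed {S S' : List (OInst L)} {t : Trace L} (h : GStep M N p S t S')
    (hS : WellFormed M S) : WellFormed M S' := by
  cases h with
  | @step I S _ σ' _ _ =>
    rintro rfl
    obtain ⟨h₁, h₂⟩ := hS rfl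
    have h₃ := (tick_le (p := p) I.conf.pcv I.win).trans h₁
    unfold nextStack
    rw [map_lowerInst_none]
    split
    · exact ⟨h₃, h₂⟩
    · refine ⟨?_, h₃, h₂⟩
      simp [newWin, budget, h₃]
  | rollback h => exact popZero_wellFormed h hS
  | stuck _ _ => exact fun e => (hS e).2

/-! ### Consistency with the non-speculative semantics -/

/-- The instances `A` speculate on top of the instance `B`. -/
structure Above (B : OInst L) (A : List (OInst L)) : Prop where
  top : B.win = ⊤
  ctr : ∀ I ∈ A, B.ctr < I.ctr
  win : ∀ I ∈ A, I.win ≠ ⊤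

theorem map_lower_above {A : List (OInst L)} {B : OInst L} (h : B.win = ⊤) (v : Val) :
    (A ++ [B]).map (lowerInst M p v) = A.map (lowerInst M p v) ++ [B] := by
  obtain ⟨_, _, _, _, _⟩ := B
  subst h
  simp [lowerInst, lowerWin_top]

/-- The rollback names the instance below the one removed. Everything above the base has a larger
counter, so the counter of the base appears only when the base itself is uncovered. The inherited
counter `c` preserves the inequality otherwise. -/
theorem Above.popZero {c : ℕ} {A S : List (OInst L)} {B : OInst L} {o : Obs L}
    (h : Above B A) (hc : B.ctr < c) (hp : popZero c (A ++ [B]) = some (o, S)) :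
    (∃ A', A' ≠ [] ∧ S = A' ++ [B] ∧ Above B A' ∧ Obs.rollback B.ctr ∉ [o]) ∨
      (S = [{ B with ctr := c }] ∧ o = .rollback B.ctr) := by
  induction A with
  | nil => simp [MuAsm.popZero] at hp
  | cons I A ih =>
    cases A with
    | nil =>
      simp only [List.cons_append, List.nil_append, MuAsm.popZero] at hp
      split_ifs at hp
      exact .inr (by simp_all)
    | cons J A =>
      simp only [List.cons_append, MuAsm.popZero] at hp
      split_ifs at hp with h'
      · simp only [Option.some.injEq, Prod.mk.injEq] at hp
        refine .inl ⟨{ J with ctr := c } :: A, by simp, hp.2.symm, ⟨h.top, ?_, ?_⟩, ?_⟩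
        · simp only [List.mem_cons, forall_eq_or_imp]
          exact ⟨hc, fun K hK => h.ctr K (by simp [hK])⟩
        · simp only [List.mem_cons, forall_eq_or_imp]
          exact ⟨h.win J (by simp), fun K hK => h.win K (by simp [hK])⟩
        · have := h.ctr J (by simp)
          simp [← hp.1, this.ne]
      · exact ih ⟨h.top, fun K hK => h.ctr K (by simp_all), fun K hK => h.win K (by simp_all)⟩ hp

theorem NSStep.rollback_notMem {σ σ' : Config L} {t : Trace L} (h : NSStep p σ t σ') (i c : ℕ)
    (s : Option ℕ) : Obs.rollback i ∉ t ++ specObs c s := by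
  have := (h.not_spec i).2
  cases s <;> simp [specObs, this]

/-- The dichotomy behind the projection: either the base stays covered and its transaction is not
closed, or the step is exactly the rollback that closes it. The base has window `⊤`, so it is never
charged. -/
theorem Above.step {A S : List (OInst L)} {B I : OInst L} {t : Trace L}
    (h : Above B (I :: A)) (hs : GStep M N p (I :: A ++ [B]) t S) :
    (∃ A', A' ≠ [] ∧ S = A' ++ [B] ∧ Above B A' ∧ Obs.rollback B.ctr ∉ t) ∨
      (∃ c, S = [{ B with ctr := c }] ∧ t = [.rollback B.ctr]) := by
  have hI := h.ctr I (by simp)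
  generalize hE : I :: A ++ [B] = E at hs
  cases hs with
  | @step I' S' t σ' _ s =>
    simp only [List.cons_append, List.cons.injEq] at hE
    obtain ⟨rfl, rfl⟩ := hE
    left
    have h₁ : ∀ K ∈ A.map (lowerInst M p I.conf.pcv), B.ctr < K.ctr := by
      intro K hK
      obtain ⟨K, hK', rfl⟩ := List.mem_map.1 hK
      exact h.ctr K (by simp [hK'])
    have h₂ : ∀ K ∈ A.map (lowerInst M p I.conf.pcv), K.win ≠ ⊤ := by
      intro K hK
      obtain ⟨K, hK', rfl⟩ := List.mem_map.1 hK
      simpa [lowerInst, lowerWin_eq_top] using h.win K (by simp [hK'])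
    have h₃ : tick p I.conf.pcv I.win ≠ ⊤ := by
      simpa [tick_eq_top] using h.win I (by simp)
    unfold nextStack
    rw [map_lower_above h.top]
    have h₄ := s.rollback_notMem B.ctr I.ctr (mispredicted p I.conf.pcv σ'.pcv I.rsb)
    split
    · refine ⟨_, List.cons_ne_nil _ _, rfl, ⟨h.top, ?_, ?_⟩, h₄⟩ <;>
        simp only [List.mem_cons, forall_eq_or_imp]
      · exact ⟨hI, h₁⟩
      · exact ⟨h₃, h₂⟩
    · refine ⟨_, List.cons_ne_nil _ (_ :: _), rfl, ⟨h.top, ?_, ?_⟩, h₄⟩ <;>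
        simp only [List.mem_cons, forall_eq_or_imp]
      · exact ⟨hI.trans (Nat.lt_succ_self _), hI, h₁⟩
      · exact ⟨newWin_ne_top _ _ _, h₃, h₂⟩
  | @rollback I' S' S'' o hp =>
    rw [← hE] at hp
    simp only [List.cons_append, List.cons.injEq] at hE
    obtain ⟨rfl, rfl⟩ := hE
    rcases h.popZero hI hp with h' | ⟨rfl, rfl⟩
    · exact .inl h'
    · exact .inr ⟨_, rfl, rfl⟩
  | @stuck I' J S' _ _ =>
    cases A with
    | nil =>
      simp only [List.cons_append, List.nil_append, List.cons.injEq] at hE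
      obtain ⟨rfl, rfl, rfl⟩ := hE
      exact .inr ⟨_, rfl, rfl⟩
    | cons K A =>
      simp only [List.cons_append, List.cons.injEq] at hE
      obtain ⟨rfl, rfl, rfl⟩ := hE
      have hK := h.ctr K (by simp)
      refine .inl ⟨{ K with ctr := I.ctr } :: A, by simp, rfl, ⟨h.top, ?_, ?_⟩, by simp [hK.ne]⟩
      · simp only [List.mem_cons, forall_eq_or_imp]
        exact ⟨hI, fun J hJ => h.ctr J (by simp [hJ])⟩
      · simp only [List.mem_cons, forall_eq_or_imp]
        exact ⟨h.win K (by simp), fun J hJ => h.win J (by simp [hJ])⟩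

/-- A step of a stack that consists of a single instance which does not speculate. -/
theorem exists_above_of_base {B : OInst L} (hB : B.win = ⊤) (σ' : Config L) :
    ∃ A B', nextStack M N p B σ' [] = A ++ [B'] ∧ Above B' A ∧ B'.conf = σ' ∧ B'.ctr = B.ctr ∧
      (mispredicted p B.conf.pcv σ'.pcv B.rsb = none ↔ A = []) := by
  unfold nextStack
  split
  · exact ⟨[], _, rfl, ⟨by simp [hB, tick_top], by simp, by simp⟩, rfl, rfl, by simp [*]⟩
  · refine ⟨[_], _, rfl, ⟨by simp [hB, tick_top], ?_, ?_⟩, rfl, rfl, by simp [*]⟩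
    · simp
    · simp [newWin_ne_top]

theorem GStep.base {B : OInst L} {S : List (OInst L)} {t : Trace L}
    (h : GStep M N p [B] t S) : ∃ t₀ σ', NSStep p B.conf t₀ σ' ∧
      t = t₀ ++ specObs B.ctr (mispredicted p B.conf.pcv σ'.pcv B.rsb) ∧
      S = nextStack M N p B σ' [] := by
  cases h with
  | step _ s => exact ⟨_, _, s, rfl, rfl⟩
  | rollback h => simp [popZero] at h

/-- The scan of the non-speculative projection inside the transaction of `B`, if there is one. -/
theorem GRun.nsProjAux {S : List (OInst L)} {t : Trace L} (h : GRun M N p S t) :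
    ∀ A B, S = A ++ [B] → Above B A →
      NSTrace p B.conf (nsProjAux (if A = [] then none else some B.ctr) t) := by
  refine GRun.induction (P := fun S t => ∀ A B, S = A ++ [B] → Above B A →
      NSTrace p B.conf (MuAsm.nsProjAux (if A = [] then none else some B.ctr) t)) ?_ ?_ h
  · intro I f A B e _
    cases A with
    | nil =>
      simp only [List.nil_append, List.cons.injEq, and_true] at e
      subst e
      exact ⟨_, .refl _, f⟩
    | cons _ A => simp at e
  · intro S t S' u s _ ih A B e hA
    subst e
    cases A with
    | nil =>
      obtain ⟨t₀, σ', hs, rfl, rfl⟩ := s.base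
      obtain ⟨A, B', e, hA', rfl, hc, hm⟩ := exists_above_of_base (M := M) (N := N) (p := p)
        hA.top σ'
      have := ih A B' e hA'
      rw [hc] at this
      -- Observations of a non-speculative step contain no `start`, so the scan copies them; it then
      -- enters the transaction of the base exactly if there is a misprediction.
      rw [if_pos rfl, List.append_assoc, nsProjAux_none_append fun i => (hs.not_spec i).1]
      refine .head hs ?_
      cases hm' : mispredicted p B.conf.pcv B'.conf.pcv B.rsb with
      | none => simpa [specObs, hm.1 hm'] using this
      | some l =>
        have hA : A ≠ [] := fun e => by simp [hm.2 e] at hm'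
        simpa [specObs, hA, MuAsm.nsProjAux] using this
    | cons I A =>
      rw [if_neg (List.cons_ne_nil _ _)]
      -- While the base is covered the scan discards everything, until the rollback with its
      -- counter.
      rcases hA.step s with ⟨A', hne, rfl, hA', hr⟩ | ⟨c, rfl, rfl⟩
      · have := ih A' B rfl hA'
        rwa [if_neg hne, ← nsProjAux_some_append hr] at this
      · have := ih [] _ rfl ⟨hA.top, by simp, by simp⟩
        simpa [MuAsm.nsProjAux] using this

/-! ### Termination of speculation -/

/-- A speculating stack cannot deadlock. The base has window `⊤`, so an exhausted instance has
another one below it and can be rolled back; a stuck top can be rolled back for the same reason. -/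
theorem Above.exists_step {A : List (OInst L)} {B I : OInst L} (h : Above B (I :: A)) :
    ∃ t S, GStep M N p (I :: A ++ [B]) t S := by
  by_cases hE : Enabled (I :: A ++ [B])
  · by_cases hs : Stuck p I.conf
    · obtain ⟨J, S, e⟩ := List.exists_cons_of_ne_nil (by simp : A ++ [B] ≠ [])
      rw [List.cons_append, e] at hE ⊢
      exact ⟨_, _, .stuck hE hs⟩
    · obtain ⟨t, σ', s⟩ := not_not.1 hs
      exact ⟨_, _, .step hE s⟩
  · suffices ∀ (c : ℕ) (A : List (OInst L)), ¬ Enabled (A ++ [B]) →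
        ∃ r, MuAsm.popZero c (A ++ [B]) = some r by
      obtain ⟨⟨o, S⟩, hr⟩ := this I.ctr (I :: A) hE
      exact ⟨_, _, .rollback hr⟩
    intro c A hA
    induction A with
    | nil => simp [Enabled, h.top] at hA
    | cons K A ih =>
      rw [List.cons_append, enabled_cons, not_and_or] at hA
      cases A with
      | nil =>
        rcases hA with hA | hA
        · simp [MuAsm.popZero, not_not.1 hA]
        · simp [Enabled, h.top] at hA
      | cons J A =>
        simp only [List.cons_append, MuAsm.popZero]
        split_ifs with h'
        · exact ⟨_, rfl⟩
        · exact ih (hA.resolve_left (not_not.2 h'))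

-- A misprediction turns one instance of budget `b` into two of budget below `b`. The base must
-- exceed `2` for `2 * 3 ^ (b - 1) < 3 ^ b` to be strict. A suffix that does not speculate has
-- budget `⊤` and counts nothing.
open Classical in
noncomputable def weight (b : ℕ∞) : ℕ := if b = ⊤ then 0 else 3 ^ b.toNat

/-- Decreases in every step of a speculating stack. -/
noncomputable def stackWeight : List (OInst L) → ℕ
  | [] => 0
  | I :: S => weight (budget (I :: S)) + stackWeight S

theorem weight_mono {a b : ℕ∞} (h : a ≤ b) (hb : b ≠ ⊤) : weight a ≤ weight b := by
  have ha : a ≠ ⊤ := ne_top_of_le_ne_top hb h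
  simp only [weight, ha, hb, if_false]
  exact Nat.pow_le_pow_right (by norm_num) (ENat.toNat_le_toNat h hb)

theorem weight_pos {a : ℕ∞} (h : a ≠ ⊤) : 0 < weight a := by
  simp [weight, h]

theorem weight_lt {a b : ℕ∞} (h : a < b) (hb : b ≠ ⊤) : 3 * weight a ≤ weight b := by
  have ha : a ≠ ⊤ := ne_top_of_le_ne_top hb h.le
  simp only [weight, ha, hb, if_false, ← pow_succ']
  lift a to ℕ using ha
  lift b to ℕ using hb
  exact Nat.pow_le_pow_right (by norm_num) (by exact_mod_cast h)

theorem stackWeight_lower (v : Val) (S : List (OInst L)) :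
    stackWeight (S.map (lowerInst M p v)) ≤ stackWeight S := by
  induction S with
  | nil => simp
  | cons I S ih =>
    have h : budget ((I :: S).map (lowerInst M p v)) = lowerWin M p v (budget (I :: S)) :=
      budget_lower v _
    rw [List.map_cons] at h ⊢
    rw [stackWeight, stackWeight, h]
    refine add_le_add ?_ ih
    by_cases h' : budget (I :: S) = ⊤
    · rw [h', lowerWin_top]
    · exact weight_mono (lowerWin_le _ _) h'

theorem stackWeight_popZero {c : ℕ} {S S' : List (OInst L)} {o : Obs L}
    (hp : popZero c S = some (o, S')) (hS : ∀ I S₁, S = I :: S₁ → I.win ≠ ⊤) :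
    stackWeight S' < stackWeight S := by
  obtain ⟨A, I, J, S₀, rfl, -, hI, e⟩ := exists_of_popZero hp
  simp only [Prod.mk.injEq] at e
  rw [e.2]
  suffices h : stackWeight (J :: S₀) < stackWeight (A ++ I :: J :: S₀) from h
  clear hp hS e
  induction A with
  | nil =>
    -- The removed instance has window `0`, and its term `3 ^ 0` is positive.
    simp only [List.nil_append, stackWeight, lt_add_iff_pos_left]
    exact weight_pos (by simp [budget, hI])
  | cons K A ih =>
    exact ih.trans_le (Nat.le_add_left _ _)

theorem GStep.stackWeight_lt {A S : List (OInst L)} {B I : OInst L} {t : Trace L}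
    (h : Above B (I :: A)) (hw : WellFormed M (I :: A ++ [B]))
    (hs : GStep M N p (I :: A ++ [B]) t S) : stackWeight S < stackWeight (I :: A ++ [B]) := by
  have hI := h.win I (by simp)
  have hI' (S) : budget (I :: S) ≠ ⊤ := ne_top_of_le_ne_top hI (min_le_left _ _)
  generalize hE : I :: A ++ [B] = E at hs hw
  cases hs with
  | @step I' S' t σ' he s =>
    obtain rfl : I = I' := by simp_all
    have hb := hw.budget_next (p := p) I.conf.pcv
    have h₁ := stackWeight_lower (M := M) (p := p) I.conf.pcv S'
    -- The new budget is `tick` of the old one, hence smaller, and its weight is at most a third;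
    -- there remains room for two such terms.
    have h₂ := weight_lt (tick_lt (p := p) (v := I.conf.pcv) (enabled_iff.1 he) (hI' S')) (hI' S')
    have h₃ := weight_pos (hI' S')
    unfold nextStack
    split
    · simp only [stackWeight]
      rw [budget, hb]
      omega
    · simp only [stackWeight]
      rw [budget, budget, hb]
      dsimp only
      -- Whatever window the mode gives the new instance, its budget is capped by the instances
      -- below it.
      have := weight_mono (min_le_right (newWin M p I.hist (I.conf.pcv.getD 0)
        (tick p I.conf.pcv I.win)) (tick p I.conf.pcv (budget (I :: S'))))
        (by simpa [tick_eq_top] using hI' S')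
      omega
  | rollback hp =>
    refine stackWeight_popZero hp ?_
    rintro J S₁ e
    rw [← hE] at e
    simp_all
  | @stuck I' J S' _ _ =>
    obtain rfl : I = I' := by simp_all
    have := weight_pos (hI' (J :: S'))
    change stackWeight (J :: S') < stackWeight (I :: J :: S')
    rw [stackWeight.eq_2 I]
    omega

/-- Speculation ends. -/
theorem Above.exists_steps {A : List (OInst L)} {B : OInst L} (h : Above B A)
    (hw : WellFormed M (A ++ [B])) :
    ∃ t c, Steps (GStep M N p) (A ++ [B]) t [{ B with ctr := c }] := by
  generalize hn : stackWeight (A ++ [B]) = n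
  induction n using Nat.strong_induction_on generalizing A with
  | _ n ih =>
    cases A with
    | nil => exact ⟨[], B.ctr, .refl _⟩
    | cons I A =>
      obtain ⟨t, S, s⟩ := h.exists_step (M := M) (N := N) (p := p)
      have hlt := s.stackWeight_lt h hw
      rcases h.step s with ⟨A', -, rfl, hA', -⟩ | ⟨c, rfl, -⟩
      · obtain ⟨u, c, hu⟩ := ih _ (hn ▸ hlt) hA' (s.wellFormed hw) rfl
        exact ⟨_, c, .head s hu⟩
      · exact ⟨_, c, .head s (.refl _)⟩

/-- After each non-speculative step the speculation it may trigger runs out and returns the base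
with a new counter only, ready for the next step. -/
theorem NSTrace.exists_gRun {σ : Config L} {u : Trace L} (h : NSTrace p σ u) (B : OInst L)
    (hB : B.win = ⊤) (hσ : B.conf = σ) : ∃ t, GRun M N p [B] t := by
  obtain ⟨σ', s, f⟩ := h
  induction s generalizing B with
  | refl => exact ⟨[], B, .refl _, hσ ▸ f⟩
  | @head _ σ₁ _ _ _ h _ ih =>
    subst hσ
    have h₁ : GStep M N p [B] _ _ := .step (by simp [Enabled, hB]) h
    obtain ⟨A, B', e, hA, rfl, -, -⟩ := exists_above_of_base (M := M) (N := N) (p := p) hB σ₁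
    rw [e] at h₁
    have hw : WellFormed M [B] := fun _ => ⟨by simp [budget], trivial⟩
    obtain ⟨t, c, hs⟩ := hA.exists_steps (N := N) (p := p) (h₁.wellFormed hw)
    obtain ⟨u, hu⟩ := ih { B' with ctr := c } hA.top rfl f
    exact ⟨_, .head h₁ (.trans hs hu)⟩

def OInst.init (σ : Config L) : OInst L := ⟨0, σ, [], [], ⊤⟩

theorem GRun.nsTrace {σ : Config L} {t : Trace L} (h : GRun M N p [.init σ] t) :
    NSTrace p σ (nsProj t) :=
  h.nsProjAux [] _ rfl ⟨rfl, by simp, by simp⟩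

theorem NSTrace.exists_nsProj_eq {σ : Config L} {u : Trace L} (h : NSTrace p σ u)
    (M : Option (RetOracle L ω)) (N : ℕ) : ∃ t, GRun M N p [.init σ] t ∧ nsProj t = u := by
  obtain ⟨t, ht⟩ := h.exists_gRun (M := M) (N := N) (.init σ) rfl rfl
  exact ⟨t, ht, ht.nsTrace.det h⟩

theorem nsProj_image {T : Config L → Trace L → Prop}
    (hT : ∀ σ t, T σ t ↔ GRun M N p [.init σ] t) :
    nsProj '' {t | ∃ σ, σ.Initial p ∧ T σ t} = behNS p := by
  ext u
  constructor
  · rintro ⟨t, ⟨σ, hσ, ht⟩, rfl⟩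
    exact ⟨σ, hσ, ((hT _ _).1 ht).nsTrace⟩
  · rintro ⟨σ, hσ, hu⟩
    obtain ⟨t, ht, rfl⟩ := hu.exists_nsProj_eq M N
    exact ⟨t, ⟨σ, hσ, (hT _ _).2 ht⟩, rfl⟩

-- Evaluation of the buffer, the prediction and the next stack by instruction

theorem rsbNext_other {v : Val} {R : List ℕ} (hr : p.instrAt v ≠ some .ret)
    (hc : ∀ f, p.instrAt v ≠ some (.call f)) : rsbNext N p v R = R := by
  unfold rsbNext; split <;> simp_all

theorem rsbNext_call {v : Val} {R : List ℕ} {f : L.Func} (h : p.instrAt v = some (.call f)) :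
    rsbNext N p v R = if R.length < N then (v.getD 0 + 1) :: R else R := by
  simp [rsbNext, h]

theorem rsbNext_ret {v : Val} {R : List ℕ} (h : p.instrAt v = some .ret) :
    rsbNext N p v R = R.tail := by
  simp [rsbNext, h]

theorem mispredicted_other {v v' : Val} {R : List ℕ} (h : p.instrAt v ≠ some .ret) :
    mispredicted p v v' R = none := by
  unfold mispredicted; split <;> simp_all

theorem mispredicted_nil (v v' : Val) : mispredicted p v v' [] = none := by
  unfold mispredicted; split <;> simp_all

theorem mispredicted_same {v : Val} (l : ℕ) (R : List ℕ) :
    mispredicted p v (some l) (l :: R) = none := by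
  unfold mispredicted; split <;> simp [Option.filter]

theorem mispredicted_cons {v v' : Val} {l : ℕ} {R : List ℕ} (h : p.instrAt v = some .ret)
    (hl : some l ≠ v') : mispredicted p v v' (l :: R) = some l := by
  simp [mispredicted, h, hl, Option.filter]

theorem nextStack_none {M : Option (RetOracle L ω)} {I : OInst L} {σ' : Config L}
    {S : List (OInst L)} (h : mispredicted p I.conf.pcv σ'.pcv I.rsb = none) :
    nextStack M N p I σ' S =
      ⟨I.ctr, σ', rsbNext N p I.conf.pcv I.rsb, I.hist, tick p I.conf.pcv I.win⟩ ::
        S.map (lowerInst M p I.conf.pcv) := by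
  simp [nextStack, h]

theorem nextStack_some {M : Option (RetOracle L ω)} {I : OInst L} {σ' : Config L}
    {S : List (OInst L)} {l : ℕ} (h : mispredicted p I.conf.pcv σ'.pcv I.rsb = some l) :
    nextStack M N p I σ' S =
      ⟨I.ctr + 1, I.conf.predict l, rsbNext N p I.conf.pcv I.rsb,
        I.hist ++ [⟨I.conf.pcv.getD 0, I.ctr, some l⟩],
        newWin M p I.hist (I.conf.pcv.getD 0) (tick p I.conf.pcv I.win)⟩ ::
      ⟨I.ctr, σ', rsbNext N p I.conf.pcv I.rsb,
        I.hist ++ [⟨I.conf.pcv.getD 0, I.ctr, σ'.pcv⟩], tick p I.conf.pcv I.win⟩ ::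
      S.map (lowerInst M p I.conf.pcv) := by
  simp [nextStack, h]

/-! ### The oracle semantics -/

theorem map_lower_of_not_barrier {O : RetOracle L ω} {v : Val} (h : p.instrAt v ≠ some .barrier)
    (S : List (OInst L)) : S.map (lowerInst (some O) p v) = decr S := by
  simp [decr, lowerInst, lowerWin, tick_of_not_barrier h]

theorem map_lower_of_barrier {O : RetOracle L ω} {v : Val} (h : p.instrAt v = some .barrier)
    (S : List (OInst L)) : S.map (lowerInst (some O) p v) = zeroes S := by
  simp [zeroes, lowerInst, lowerWin, tick, h]

theorem gStep_of_none {M : Option (RetOracle L ω)} {I : OInst L} {σ' : Config L}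
    {S : List (OInst L)} {t : Trace L} (he : Enabled (I :: S)) (s : NSStep p I.conf t σ')
    (h : mispredicted p I.conf.pcv σ'.pcv I.rsb = none) :
    GStep M N p (I :: S) t
      (⟨I.ctr, σ', rsbNext N p I.conf.pcv I.rsb, I.hist, tick p I.conf.pcv I.win⟩ ::
        S.map (lowerInst M p I.conf.pcv)) := by
  have := GStep.step (M := M) (N := N) he s
  rwa [nextStack_none h, h, specObs, List.append_nil] at this

/-- Charging by `tick` is `decr` away from barriers and `zeroes` at a barrier; for returns, the new
program counter is the value read from the stack. -/
theorem OStep.gStep {O : RetOracle L ω} {S S' : List (OInst L)} {t : Trace L}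
    (h : OStep N O p S t S') : GStep (some O) N p S t S' := by
  cases h with
  | noSpec e s hb hr hc =>
    have := gStep_of_none (M := some O) (N := N) e s (mispredicted_other hr)
    rwa [map_lower_of_not_barrier hb, tick_of_not_barrier hb, rsbNext_other hr hc] at this
  | barrier e s hb =>
    have := gStep_of_none (M := some O) (N := N) e s (mispredicted_other (by simp [hb]))
    rw [map_lower_of_barrier hb, rsbNext_other (by simp [hb]) (by simp [hb])] at this
    simpa [tick, hb, zeroes] using this
  | @call _ k f _ _ _ _ _ _ _ e s hk hc hN =>
    have hb : p.instrAt (some k) ≠ some .barrier := by rw [← hk, hc]; simp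
    have := gStep_of_none (M := some O) (N := N) e s (mispredicted_other (by simp [hc]))
    rw [rsbNext_call hc, if_pos hN] at this
    simp only [Config.pcv, hk, map_lower_of_not_barrier hb, tick_of_not_barrier hb,
      Option.getD_some] at this
    exact this
  | callFull e s hc hN =>
    have hb := hc.trans_ne (by simp : _ ≠ some .barrier)
    have := gStep_of_none (M := some O) (N := N) e s (mispredicted_other (by simp [hc]))
    rwa [rsbNext_call hc, if_neg (not_lt.2 hN), map_lower_of_not_barrier hb,
      tick_of_not_barrier hb] at this
  | retEmpty e s hr =>
    have hb := hr.trans_ne (by simp : _ ≠ some .barrier)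
    have := gStep_of_none (M := some O) (N := N) e s (mispredicted_nil _ _)
    rwa [rsbNext_ret hr, map_lower_of_not_barrier hb, tick_of_not_barrier hb] at this
  | retSame e s hr hl =>
    have hb := hr.trans_ne (by simp : _ ≠ some .barrier)
    have := gStep_of_none (M := some O) (N := N) e s
      (by rw [s.pc_of_ret hr, ← hl]; exact mispredicted_same _ _)
    rwa [rsbNext_ret hr, map_lower_of_not_barrier hb, tick_of_not_barrier hb] at this
  | retSpec e s hk hr hl =>
    have hb := hr.trans_ne (by simp : _ ≠ some .barrier)
    have hm := mispredicted_cons (R := ‹_›) hr ((s.pc_of_ret hr).symm ▸ hl)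
    have := GStep.step (M := some O) (N := N) e s
    rw [nextStack_some hm, hm, map_lower_of_not_barrier hb, tick_of_not_barrier hb,
      rsbNext_ret hr, s.pc_of_ret hr] at this
    simp only [Config.pcv, hk, Option.getD_some] at this
    exact this
  | @rollback A S T I J top e hA hI =>
    have := popZero_append (c := top.ctr) (S := S) (J := J) hA hI
    rw [e] at this ⊢
    exact .rollback this
  | rollbackStuck e h => exact .stuck e h

theorem GStep.oStep {O : RetOracle L ω} {S S' : List (OInst L)} {t : Trace L}
    (h : GStep (some O) N p S t S') : OStep N O p S t S' := by
  cases h with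
  | @step I S t σ' e s =>
    obtain ⟨c, σ, R, h, w⟩ := I
    obtain ⟨k, hk⟩ := s.exists_pc
    dsimp only at s hk ⊢
    by_cases hr : p.instrAt σ.pcv = some .ret
    · have hb := hr.trans_ne (by simp : _ ≠ some .barrier)
      cases R with
      | nil =>
        rw [mispredicted_nil, specObs, List.append_nil, nextStack_none (mispredicted_nil _ _)]
        rw [rsbNext_ret hr, map_lower_of_not_barrier hb, tick_of_not_barrier hb]
        exact .retEmpty e s hr
      | cons l R =>
        by_cases hl : some l = σ'.pcv
        · rw [nextStack_none (by rw [← hl]; exact mispredicted_same _ _), ← hl, mispredicted_same,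
            specObs, List.append_nil]
          rw [rsbNext_ret hr, map_lower_of_not_barrier hb, tick_of_not_barrier hb]
          exact .retSame e s hr (hl.trans (s.pc_of_ret hr))
        · rw [nextStack_some (mispredicted_cons hr hl), mispredicted_cons hr hl]
          rw [rsbNext_ret hr, map_lower_of_not_barrier hb, tick_of_not_barrier hb,
            s.pc_of_ret hr, hk]
          exact .retSpec e s hk hr (s.pc_of_ret hr ▸ hl)
    · rw [nextStack_none (mispredicted_other hr), mispredicted_other hr, specObs,
        List.append_nil]
      by_cases hb : p.instrAt σ.pcv = some .barrier
      · rw [map_lower_of_barrier hb, rsbNext_other hr (by simp [hb])]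
        have := OStep.barrier (O := O) (N := N) e s hb
        simpa [tick, hb, zeroes] using this
      · rw [map_lower_of_not_barrier hb, tick_of_not_barrier hb]
        by_cases hc : ∃ f, p.instrAt σ.pcv = some (.call f)
        · obtain ⟨f, hc⟩ := hc
          rw [rsbNext_call hc]
          split_ifs with hN
          · rw [hk]
            exact .call e s hk hc hN
          · exact .callFull e s hc (not_lt.1 hN)
        · rw [rsbNext_other hr (not_exists.1 hc)]
          exact .noSpec e s hb hr (not_exists.1 hc)
  | @rollback I S S' o hp =>
    obtain ⟨A, I', J, S₀, e, hA, hI, hr⟩ := exists_of_popZero hp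
    simp only [Prod.mk.injEq] at hr
    rw [hr.1, hr.2, e]
    exact .rollback e.symm hA hI
  | stuck e h => exact .rollbackStuck e h

theorem Steps.mono {S E : Type} {r r' : S → List E → S → Prop} (h : ∀ a t b, r a t b → r' a t b)
    {a b : S} {t : List E} (hs : Steps r a t b) : Steps r' a t b := by
  induction hs with
  | refl => exact .refl _
  | head hs _ ih => exact .head (h _ _ _ hs) ih

theorem oTrace_iff (O : RetOracle L ω) (σ : Config L) (t : Trace L) :
    OTrace N O p σ t ↔ GRun (some O) N p [.init σ] t :=
  ⟨fun ⟨I, s, f⟩ => ⟨I, s.mono fun _ _ _ => OStep.gStep, f⟩,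
    fun ⟨I, s, f⟩ => ⟨I, s.mono fun _ _ _ => GStep.oStep, f⟩⟩

/-! ### The always-mispredict semantics -/

noncomputable def amNext (ω N : ℕ) (p : Program L) (I : Inst L) (σ' : Config L)
    (S : List (Inst L)) : List (Inst L) :=
  match mispredicted p I.conf.pcv σ'.pcv I.rsb with
  | none => ⟨I.ctr, σ', rsbNext N p I.conf.pcv I.rsb, tick p I.conf.pcv I.win⟩ :: S
  | some l =>
      ⟨I.ctr + 1, I.conf.predict l, rsbNext N p I.conf.pcv I.rsb,
        min (ω : ℕ∞) (tick p I.conf.pcv I.win)⟩ ::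
      ⟨I.ctr, σ', rsbNext N p I.conf.pcv I.rsb, tick p I.conf.pcv I.win⟩ :: S

theorem amNext_none {I : Inst L} {σ' : Config L} {S : List (Inst L)}
    (h : mispredicted p I.conf.pcv σ'.pcv I.rsb = none) :
    amNext ω N p I σ' S =
      ⟨I.ctr, σ', rsbNext N p I.conf.pcv I.rsb, tick p I.conf.pcv I.win⟩ :: S := by
  simp [amNext, h]

theorem amNext_some {I : Inst L} {σ' : Config L} {S : List (Inst L)} {l : ℕ}
    (h : mispredicted p I.conf.pcv σ'.pcv I.rsb = some l) :
    amNext ω N p I σ' S =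
      ⟨I.ctr + 1, I.conf.predict l, rsbNext N p I.conf.pcv I.rsb,
        min (ω : ℕ∞) (tick p I.conf.pcv I.win)⟩ ::
      ⟨I.ctr, σ', rsbNext N p I.conf.pcv I.rsb, tick p I.conf.pcv I.win⟩ :: S := by
  simp [amNext, h]

theorem AMStep.of_nsStep {I : Inst L} {σ' : Config L} {S : List (Inst L)} {t : Trace L}
    (hw : I.win ≠ 0) (s : NSStep p I.conf t σ') :
    AMStep ω N p (I :: S) (t ++ specObs I.ctr (mispredicted p I.conf.pcv σ'.pcv I.rsb))
      (amNext ω N p I σ' S) := by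
  obtain ⟨c, σ, R, w⟩ := I
  obtain ⟨k, hk⟩ := s.exists_pc
  dsimp only at s hk hw ⊢
  have hw' := ENat.exists_eq_add_one hw
  by_cases hr : p.instrAt σ.pcv = some .ret
  · have hb := hr.trans_ne (by simp : _ ≠ some .barrier)
    cases R with
    | nil =>
      rw [mispredicted_nil, specObs, List.append_nil, amNext_none (mispredicted_nil _ _)]
      rw [rsbNext_ret hr, tick_of_not_barrier hb]
      exact .retEmpty hw' s hr
    | cons l R =>
      by_cases hl : some l = σ'.pcv
      · rw [amNext_none (by rw [← hl]; exact mispredicted_same _ _), ← hl, mispredicted_same,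
          specObs, List.append_nil]
        rw [rsbNext_ret hr, tick_of_not_barrier hb]
        exact .retSame hw' s hr (hl.trans (s.pc_of_ret hr))
      · rw [amNext_some (mispredicted_cons hr hl), mispredicted_cons hr hl]
        rw [rsbNext_ret hr, tick_of_not_barrier hb]
        exact .retSpec hw' s hr (s.pc_of_ret hr ▸ hl)
  · rw [amNext_none (mispredicted_other hr), mispredicted_other hr, specObs, List.append_nil]
    by_cases hb : p.instrAt σ.pcv = some .barrier
    · rw [rsbNext_other hr (by simp [hb]), tick, if_pos hb]
      dsimp only
      split_ifs with h
      · subst h; exact .barrier s hb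
      · exact .barrierSpec hw h s hb
    · rw [tick_of_not_barrier hb]
      by_cases hc : ∃ f, p.instrAt σ.pcv = some (.call f)
      · obtain ⟨f, hc⟩ := hc
        rw [rsbNext_call hc]
        split_ifs with hN
        · rw [hk]
          exact .call hw' s hk hc hN
        · exact .callFull hw' s hc (not_lt.1 hN)
      · rw [rsbNext_other hr (not_exists.1 hc)]
        exact .noSpec hw' s hb hr (not_exists.1 hc)

theorem AMStep.of_nsStep_none {I : Inst L} {σ' : Config L} {S S' : List (Inst L)} {t : Trace L}
    (s : NSStep p I.conf t σ') (h : mispredicted p I.conf.pcv σ'.pcv I.rsb = none)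
    (hS : S' = ⟨I.ctr, σ', rsbNext N p I.conf.pcv I.rsb, tick p I.conf.pcv I.win⟩ :: S) :
    ∃ t₀ σ'', NSStep p I.conf t₀ σ'' ∧
        t = t₀ ++ specObs I.ctr (mispredicted p I.conf.pcv σ''.pcv I.rsb) ∧
        S' = amNext ω N p I σ'' S :=
  ⟨t, σ', s, by simp [h, specObs], by rw [amNext_none h, hS]⟩

/-- Condenses the eight rules that execute an instruction into one alternative and leaves the
rollback as the other. -/
theorem AMStep.cases_top {I : Inst L} {S S' : List (Inst L)} {t : Trace L}
    (h : AMStep ω N p (I :: S) t S') :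
    (I.win ≠ 0 ∧ ∃ t₀ σ', NSStep p I.conf t₀ σ' ∧
        t = t₀ ++ specObs I.ctr (mispredicted p I.conf.pcv σ'.pcv I.rsb) ∧
        S' = amNext ω N p I σ' S) ∨
      ∃ J S₀, S = J :: S₀ ∧ (I.win = 0 ∨ Stuck p I.conf) ∧ t = [.rollback J.ctr] ∧
        S' = { J with ctr := I.ctr } :: S₀ := by
  cases h with
  | noSpec hw s hb hr hc =>
    subst hw
    refine .inl ⟨by simp, of_nsStep_none s (mispredicted_other hr) ?_⟩
    rw [rsbNext_other hr hc, tick_of_not_barrier hb, ENat.add_one_sub_one]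
  | barrier s hb =>
    refine .inl ⟨by simp, of_nsStep_none s (mispredicted_other (by simp [hb])) ?_⟩
    rw [rsbNext_other (by simp [hb]) (by simp [hb]), tick_top]
  | barrierSpec hw h s hb =>
    refine .inl ⟨hw, of_nsStep_none s (mispredicted_other (by simp [hb])) ?_⟩
    rw [rsbNext_other (by simp [hb]) (by simp [hb]), tick, if_pos hb, if_neg h]
  | call hw s hk hc hN =>
    have hb := hc.trans_ne (by simp : _ ≠ some .barrier)
    subst hw
    refine .inl ⟨by simp, of_nsStep_none s (mispredicted_other (by simp [hc])) ?_⟩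
    rw [rsbNext_call hc, tick_of_not_barrier hb, ENat.add_one_sub_one, if_pos hN]
    simp only [hk, Option.getD_some]
  | callFull hw s hc hN =>
    have hb := hc.trans_ne (by simp : _ ≠ some .barrier)
    subst hw
    refine .inl ⟨by simp, of_nsStep_none s (mispredicted_other (by simp [hc])) ?_⟩
    rw [rsbNext_call hc, tick_of_not_barrier hb, ENat.add_one_sub_one, if_neg (not_lt.2 hN)]
  | retEmpty hw s hr =>
    have hb := hr.trans_ne (by simp : _ ≠ some .barrier)
    subst hw
    refine .inl ⟨by simp, of_nsStep_none s (mispredicted_nil _ _) ?_⟩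
    rw [rsbNext_ret hr, tick_of_not_barrier hb, ENat.add_one_sub_one, List.tail_nil]
  | retSame hw s hr hl =>
    have hb := hr.trans_ne (by simp : _ ≠ some .barrier)
    subst hw
    refine .inl ⟨by simp, of_nsStep_none s
      (by rw [s.pc_of_ret hr, ← hl]; exact mispredicted_same _ _) ?_⟩
    rw [rsbNext_ret hr, tick_of_not_barrier hb, ENat.add_one_sub_one, List.tail_cons]
  | @retSpec c l σ σ' R _ _ _ S hw s hr hl =>
    have hb := hr.trans_ne (by simp : _ ≠ some .barrier)
    subst hw
    have hm : mispredicted p σ.pcv σ'.pcv (l :: R) = some l :=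
      mispredicted_cons hr (by rwa [s.pc_of_ret hr])
    refine .inl ⟨by simp, _, _, s, by rw [hm]; rfl, ?_⟩
    rw [amNext_some hm, rsbNext_ret hr, tick_of_not_barrier hb, ENat.add_one_sub_one,
      List.tail_cons]
    rfl
  | rollback h => exact .inr ⟨_, _, rfl, h, rfl, rfl⟩

def OInst.erase (I : OInst L) : Inst L := ⟨I.ctr, I.conf, I.rsb, I.win⟩

theorem map_erase_nextStack (I : OInst L) (σ' : Config L) (S : List (OInst L)) :
    (nextStack (none : Option (RetOracle L ω)) N p I σ' S).map OInst.erase =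
      amNext ω N p I.erase σ' (S.map OInst.erase) := by
  unfold nextStack amNext
  rw [map_lowerInst_none]
  change _ = match mispredicted p I.conf.pcv σ'.pcv I.rsb with | none => _ | some l => _
  split <;> simp_all [OInst.erase, newWin]

/-- The reason why the top window alone decides in the always-mispredict semantics. -/
theorem WinMono.enabled {I : OInst L} {S : List (OInst L)} (h : WinMono (I :: S))
    (hI : I.win ≠ 0) : Enabled (I :: S) := by
  rw [enabled_iff, budget, min_eq_left h.1]
  exact hI

theorem WinMono.exists_of_popZero {I : OInst L} {S S' : List (OInst L)} {c : ℕ} {o : Obs L}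
    (h : WinMono (I :: S)) (hp : popZero c (I :: S) = some (o, S')) :
    ∃ J S₀, S = J :: S₀ ∧ I.win = 0 ∧ o = .rollback J.ctr ∧ S' = { J with ctr := c } :: S₀ := by
  have hI : I.win = 0 := by
    by_contra hI
    exact not_enabled_of_popZero hp (h.enabled hI)
  cases S with
  | nil => simp [popZero] at hp
  | cons J S =>
    simp only [popZero, if_pos hI, Option.some.injEq, Prod.mk.injEq] at hp
    exact ⟨J, S, rfl, hI, hp.1.symm, hp.2.symm⟩

theorem GStep.amStep {S S' : List (OInst L)} {t : Trace L} (hS : WinMono S)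
    (h : GStep (none : Option (RetOracle L ω)) N p S t S') :
    AMStep ω N p (S.map OInst.erase) t (S'.map OInst.erase) := by
  cases h with
  | step e s =>
    rw [map_erase_nextStack]
    exact AMStep.of_nsStep (I := OInst.erase _) (enabled_cons.1 e).1 s
  | rollback hp =>
    obtain ⟨J, S₀, rfl, hI, rfl, rfl⟩ := hS.exists_of_popZero hp
    exact .rollback (.inl hI)
  | stuck e h => exact .rollback (.inr h)

theorem AMStep.exists_gStep {G : List (OInst L)} {S' : List (Inst L)} {t : Trace L}
    (hG : WinMono G) (h : AMStep ω N p (G.map OInst.erase) t S') :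
    ∃ G', GStep (none : Option (RetOracle L ω)) N p G t G' ∧ G'.map OInst.erase = S' := by
  cases G with
  | nil => cases h
  | cons I G =>
    rcases h.cases_top with ⟨hw, t₀, σ', s, rfl, rfl⟩ | ⟨J, S₀, e, hI, rfl, rfl⟩
    · exact ⟨_, .step (hG.enabled hw) s, map_erase_nextStack _ _ _⟩
    · cases G with
      | nil => simp at e
      | cons K G =>
        simp only [List.map_cons, List.cons.injEq] at e
        obtain ⟨rfl, rfl⟩ := e
        by_cases h0 : I.win = 0
        · exact ⟨{ K with ctr := I.ctr } :: G, .rollback (by rw [popZero, if_pos h0]; rfl), rfl⟩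
        · exact ⟨_, .stuck (hG.enabled h0) (hI.resolve_left h0), rfl⟩

/-- A simulation in both directions through `OInst.erase`, along which `WinMono` is preserved; the
histories erased on one side are rebuilt by the steps of `GStep` on the other. -/
theorem amTrace_iff (σ : Config L) (t : Trace L) :
    AMTrace ω N p σ t ↔ GRun (none : Option (RetOracle L ω)) N p [.init σ] t := by
  have h₀ : WinMono [OInst.init σ] := ⟨by simp [budget], trivial⟩
  constructor
  · rintro ⟨I, s, f⟩
    suffices ∀ S S' t, Steps (AMStep ω N p) S t S' → S' = [I] → ∀ G, WinMono G →
        G.map OInst.erase = S → GRun (none : Option (RetOracle L ω)) N p G t from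
      this _ _ _ s rfl _ h₀ rfl
    intro S S' t hs
    induction hs with
    | refl =>
      rintro rfl G _ e
      obtain ⟨J, rfl, rfl⟩ := List.map_eq_singleton_iff.1 e
      exact ⟨J, .refl _, f⟩
    | head h _ ih =>
      rintro rfl G hG rfl
      obtain ⟨G', hs, rfl⟩ := h.exists_gStep hG
      exact .head hs (ih rfl _ (hs.wellFormed (fun _ => hG) rfl) rfl)
  · intro h
    suffices ∀ S t, GRun (none : Option (RetOracle L ω)) N p S t → WinMono S →
        ∃ I : Inst L, Steps (AMStep ω N p) (S.map OInst.erase) t [I] ∧ I.conf.Final from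
      this _ _ h h₀
    intro S t h
    refine GRun.induction (P := fun S t => WinMono S →
        ∃ I : Inst L, Steps (AMStep ω N p) (S.map OInst.erase) t [I] ∧ I.conf.Final) ?_ ?_ h
    · exact fun I f _ => ⟨I.erase, .refl _, f⟩
    · intro S t S' u hs _ ih hS
      obtain ⟨I, s, f⟩ := ih (hs.wellFormed (fun _ => hS) rfl)
      exact ⟨I, .head (hs.amStep hS) s, f⟩

/-! ### Pairs of runs -/

/-- The instances agree on everything but the data in memory and registers. -/
structure OInst.Low (I J : OInst L) : Prop where
  ctr : I.ctr = J.ctr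
  rsb : I.rsb = J.rsb
  hist : I.hist = J.hist
  win : I.win = J.win
  pc : I.conf.pcv = J.conf.pcv

abbrev LowStack : List (OInst L) → List (OInst L) → Prop := List.Forall₂ OInst.Low

theorem OInst.Low.lower {I J : OInst L} (h : I.Low J) (v : Val) :
    (lowerInst M p v I).Low (lowerInst M p v J) :=
  ⟨h.ctr, h.rsb, h.hist, by simp [lowerInst, h.win], h.pc⟩

theorem OInst.Low.setCtr {I J : OInst L} (h : I.Low J) (c : ℕ) :
    OInst.Low { I with ctr := c } { J with ctr := c } :=
  ⟨rfl, h.rsb, h.hist, h.win, h.pc⟩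

theorem LowStack.lower {S T : List (OInst L)} (h : LowStack S T) (v : Val) :
    LowStack (S.map (lowerInst M p v)) (T.map (lowerInst M p v)) := by
  rw [LowStack, List.forall₂_map_left_iff, List.forall₂_map_right_iff]
  exact h.imp fun _ _ h => h.lower v

theorem LowStack.enabled {S T : List (OInst L)} (h : LowStack S T) (hS : Enabled S) :
    Enabled T := by
  induction h with
  | nil => exact hS
  | cons h _ ih =>
    rw [enabled_cons] at hS ⊢
    exact ⟨h.win ▸ hS.1, ih hS.2⟩

/-- Buffers, windows, histories and predictions are functions of control data, so equal new program
counters suffice. -/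
theorem LowStack.nextStack {I J : OInst L} {S T : List (OInst L)} {σ τ : Config L}
    (h : LowStack (I :: S) (J :: T)) (hpc : σ.pcv = τ.pcv) :
    LowStack (nextStack M N p I σ S) (nextStack M N p J τ T) := by
  obtain ⟨⟨h₁, h₂, h₃, h₄, h₅⟩, hS⟩ := List.forall₂_cons.1 h
  have hl := LowStack.lower (M := M) (p := p) hS J.conf.pcv
  unfold MuAsm.nextStack
  rw [h₁, h₂, h₃, h₄, h₅, hpc]
  split
  · exact .cons ⟨rfl, rfl, rfl, rfl, hpc⟩ hl
  · exact .cons ⟨rfl, rfl, rfl, rfl, by simp [Config.predict, Config.pcv, setReg_same]⟩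
      (.cons ⟨rfl, rfl, rfl, rfl, hpc⟩ hl)

theorem NSStep.pc_congr {σ₁ σ₂ σ₁' σ₂' : Config L} {t : Trace L} (h₁ : NSStep p σ₁ t σ₁')
    (h₂ : NSStep p σ₂ t σ₂') (e : σ₁.pcv = σ₂.pcv) : σ₁'.pcv = σ₂'.pcv := by
  rw [h₁.pc_eq, h₂.pc_eq, e]

/-- The pairs of configurations (with return stack buffer and window) that are reached from the
pair `ρ₁`, `ρ₂` along a path, with the same observations. The path records for every
misprediction whether it is followed. -/
inductive PairReach (ω N : ℕ) (p : Program L) (ρ₁ ρ₂ : Config L) :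
    Config L → Config L → List ℕ → ℕ∞ → List Bool → Prop where
  | init : PairReach ω N p ρ₁ ρ₂ ρ₁ ρ₂ [] ⊤ []
  | step {σ₁ σ₂ σ₁' σ₂' : Config L} {R : List ℕ} {w : ℕ∞} {q : List Bool} {t : Trace L} :
      PairReach ω N p ρ₁ ρ₂ σ₁ σ₂ R w q → w ≠ 0 → NSStep p σ₁ t σ₁' → NSStep p σ₂ t σ₂' →
      mispredicted p σ₁.pcv σ₁'.pcv R = none →
      PairReach ω N p ρ₁ ρ₂ σ₁' σ₂' (rsbNext N p σ₁.pcv R) (tick p σ₁.pcv w) q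
  | actual {σ₁ σ₂ σ₁' σ₂' : Config L} {R : List ℕ} {w : ℕ∞} {q : List Bool} {t : Trace L}
      {l : ℕ} :
      PairReach ω N p ρ₁ ρ₂ σ₁ σ₂ R w q → w ≠ 0 → NSStep p σ₁ t σ₁' → NSStep p σ₂ t σ₂' →
      mispredicted p σ₁.pcv σ₁'.pcv R = some l →
      PairReach ω N p ρ₁ ρ₂ σ₁' σ₂' (rsbNext N p σ₁.pcv R) (tick p σ₁.pcv w) (q ++ [false])
  | predicted {σ₁ σ₂ σ₁' σ₂' : Config L} {R : List ℕ} {w : ℕ∞} {q : List Bool} {t : Trace L}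
      {l : ℕ} :
      PairReach ω N p ρ₁ ρ₂ σ₁ σ₂ R w q → w ≠ 0 → NSStep p σ₁ t σ₁' → NSStep p σ₂ t σ₂' →
      mispredicted p σ₁.pcv σ₁'.pcv R = some l →
      PairReach ω N p ρ₁ ρ₂ (σ₁.predict l) (σ₂.predict l) (rsbNext N p σ₁.pcv R)
        (min (ω : ℕ∞) (tick p σ₁.pcv w)) (q ++ [true])

/-- Along all paths from `ρ₁`, `ρ₂` the observations agree. -/
def PathsAgree (ω N : ℕ) (p : Program L) (ρ₁ ρ₂ : Config L) : Prop :=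
  ∀ σ₁ σ₂ R w q t₁ t₂ σ₁' σ₂', PairReach ω N p ρ₁ ρ₂ σ₁ σ₂ R w q → w ≠ 0 →
    NSStep p σ₁ t₁ σ₁' → NSStep p σ₂ t₂ σ₂' → t₁ = t₂

/-! ### Agreement along all paths implies equality of traces -/

/-- Each pair of instances lies at the end of a path. The bound concerns the budget of the stack
from there downwards, not the window of the instance: an oracle may hand out a window larger than
what remains below, but the budget limits the steps actually made. -/
inductive Covered (ω N : ℕ) (p : Program L) (ρ₁ ρ₂ : Config L) :
    List (OInst L) → List (OInst L) → Prop where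
  | nil : Covered ω N p ρ₁ ρ₂ [] []
  | cons {I J : OInst L} {S T : List (OInst L)} {w : ℕ∞} {q : List Bool} :
      PairReach ω N p ρ₁ ρ₂ I.conf J.conf I.rsb w q → budget (I :: S) ≤ w → I.Low J →
      Covered ω N p ρ₁ ρ₂ S T → Covered ω N p ρ₁ ρ₂ (I :: S) (J :: T)

section Covered

variable {ρ₁ ρ₂ : Config L}

theorem Covered.low {S T : List (OInst L)} (h : Covered ω N p ρ₁ ρ₂ S T) : LowStack S T := by
  induction h with
  | nil => exact .nil
  | cons _ _ h _ ih => exact .cons h ih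

theorem Covered.lower {S T : List (OInst L)} (h : Covered ω N p ρ₁ ρ₂ S T) (v : Val) :
    Covered ω N p ρ₁ ρ₂ (S.map (lowerInst M p v)) (T.map (lowerInst M p v)) := by
  induction h with
  | nil => exact .nil
  | @cons I J S T w q h₁ h₂ h₃ _ ih =>
    refine .cons (I := lowerInst M p v I) (J := lowerInst M p v J) h₁ ?_ (h₃.lower v) ih
    exact (budget_lower v (I :: S)).trans_le ((lowerWin_le _ _).trans h₂)

theorem Covered.setCtr {I J : OInst L} {S T : List (OInst L)}
    (h : Covered ω N p ρ₁ ρ₂ (I :: S) (J :: T)) (c : ℕ) :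
    Covered ω N p ρ₁ ρ₂ ({ I with ctr := c } :: S) ({ J with ctr := c } :: T) := by
  cases h with
  | cons h₁ h₂ h₃ h₄ => exact .cons h₁ h₂ (h₃.setCtr c) h₄

theorem Covered.popZero {S T S' : List (OInst L)} {o : Obs L} {c : ℕ}
    (h : Covered ω N p ρ₁ ρ₂ S T) (hp : popZero c S = some (o, S')) :
    ∃ T', MuAsm.popZero c T = some (o, T') ∧ Covered ω N p ρ₁ ρ₂ S' T' := by
  induction h with
  | nil => simp [MuAsm.popZero] at hp
  | cons _ _ h₃ h₄ ih =>
    cases h₄ with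
    | nil => simp [MuAsm.popZero] at hp
    | cons h₁ h₂ h₃' h₄ =>
      simp only [MuAsm.popZero] at hp ⊢
      rw [← h₃.win]
      split_ifs at hp with h'
      · simp only [Option.some.injEq, Prod.mk.injEq] at hp
        obtain ⟨rfl, rfl⟩ := hp
        rw [if_pos h', h₃'.ctr]
        exact ⟨_, rfl, (Covered.cons h₁ h₂ h₃' h₄).setCtr c⟩
      · rw [if_neg h']
        exact ih hp

theorem newWin_le (h : List HistEntry) (k : ℕ) (w : ℕ∞) : newWin M p h k w ≤ ω := by
  cases M with
  | none => exact min_le_left _ _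
  | some O => exact Nat.cast_le.2 (O.window_le p h k)

/-- The second stack can copy every step of the first. For instructions, agreement on the path of
the top pair supplies equal observations; rollbacks depend only on windows, counters and program
counters. -/
theorem Covered.step (ha : PathsAgree ω N p ρ₁ ρ₂) {S T S' : List (OInst L)} {t : Trace L}
    (h : Covered ω N p ρ₁ ρ₂ S T) (hw : WellFormed M S) (hs : GStep M N p S t S') :
    ∃ T', GStep M N p T t T' ∧ Covered ω N p ρ₁ ρ₂ S' T' := by
  cases hs with
  | @step I S t σ' he s =>
    have he' := h.low.enabled he
    have hb := hw.budget_next (p := p) I.conf.pcv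
    cases h with
    | @cons _ J _ T w q h₁ h₂ h₃ h₄ =>
      -- An enabled stack has nonzero budget, so the path still has a nonzero window and may be
      -- prolonged.
      have hw0 : w ≠ 0 := fun e => enabled_iff.1 he (le_zero_iff.1 (e ▸ h₂))
      obtain ⟨t', τ', s'⟩ := s.exists_of_pc_eq h₃.pc
      obtain rfl := ha _ _ _ _ _ _ _ _ _ h₁ hw0 s s'
      have hpc := s.pc_congr s' h₃.pc
      have ht := tick_mono (p := p) I.conf.pcv h₂
      refine ⟨nextStack M N p J τ' T, ?_, ?_⟩
      · rw [h₃.ctr, h₃.pc, h₃.rsb, hpc]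
        exact .step he' s'
      have hl := h₄.lower (M := M) I.conf.pcv
      have hlow := LowStack.nextStack (M := M) (N := N) (p := p) (.cons h₃ h₄.low) hpc
      cases hm : mispredicted p I.conf.pcv σ'.pcv I.rsb with
      | none =>
        have hm' := hm
        rw [h₃.pc, h₃.rsb, hpc] at hm'
        rw [nextStack_none hm, nextStack_none hm', ← h₃.pc] at hlow ⊢
        exact .cons (h₁.step hw0 s s' hm) (hb.trans_le ht) (List.forall₂_cons.1 hlow).1 hl
      | some l =>
        have hm' := hm
        rw [h₃.pc, h₃.rsb, hpc] at hm'
        rw [nextStack_some hm, nextStack_some hm', ← h₃.pc] at hlow ⊢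
        obtain ⟨l₁, hlow⟩ := List.forall₂_cons.1 hlow
        refine .cons (h₁.predicted hw0 s s' hm) ?_ l₁
          (.cons (h₁.actual hw0 s s' hm) (hb.trans_le ht) (List.forall₂_cons.1 hlow).1 hl)
        -- The path window `min ω (tick w)` dominates in every mode: the new window is at most `ω`,
        -- and the rest of the stack has budget at most `tick w`.
        exact min_le_min (newWin_le _ _ _) (hb.trans_le ht)
  | rollback hp =>
    have hc : ∀ I J S T, Covered ω N p ρ₁ ρ₂ (I :: S) (J :: T) → I.ctr = J.ctr :=
      fun I J S T h => (List.forall₂_cons.1 h.low).1.ctr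
    obtain ⟨T', hT, hc'⟩ := h.popZero hp
    cases T with
    | nil => cases h
    | cons J T =>
      rw [hc _ _ _ _ h] at hT
      exact ⟨T', .rollback hT, hc'⟩
  | stuck he hs =>
    have he' := h.low.enabled he
    cases h with
    | cons _ _ h₃ h₄ =>
      cases h₄ with
      | cons h₁' h₂' h₃' h₄' =>
        refine ⟨_, ?_, (Covered.cons h₁' h₂' h₃' h₄').setCtr _⟩
        rw [h₃.ctr, h₃'.ctr]
        exact .stuck he' (hs.of_pc_eq h₃.pc)

/-- The first run is replayed from the second configuration; determinism identifies the replay with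
the second run. -/
theorem PathsAgree.eq_of_gRun (ha : PathsAgree ω N p ρ₁ ρ₂) (hpc : ρ₁.pcv = ρ₂.pcv)
    {t₁ t₂ : Trace L} (h₁ : GRun M N p [.init ρ₁] t₁) (h₂ : GRun M N p [.init ρ₂] t₂) :
    t₁ = t₂ := by
  suffices ∀ S t, GRun M N p S t → ∀ T, Covered ω N p ρ₁ ρ₂ S T → WellFormed M S →
      GRun M N p T t by
    refine GRun.det (this _ _ h₁ _ ?_ ?_) h₂
    · exact .cons (I := .init ρ₁) (J := .init ρ₂) .init le_top ⟨rfl, rfl, rfl, rfl, hpc⟩ .nil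
    · exact fun _ => ⟨by simp [budget], trivial⟩
  intro S t h
  refine GRun.induction (P := fun S t => ∀ T, Covered ω N p ρ₁ ρ₂ S T → WellFormed M S →
      GRun M N p T t) ?_ ?_ h
  · rintro I f T hT -
    cases hT with
    | cons _ _ h₃ h₄ =>
      cases h₄
      exact ⟨_, .refl _, h₃.pc.symm.trans f⟩
  · intro S t S' u hs _ ih T hT hw
    obtain ⟨T', hs', hT'⟩ := hT.step ha hw hs
    exact .head hs' (ih _ hT' (hs.wellFormed hw))

end Covered

/-! ### Equality of traces implies agreement along paths -/

/-- Stacks with terminating runs that produce the same trace. -/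
def PairRun (M : Option (RetOracle L ω)) (N : ℕ) (p : Program L) (S T : List (OInst L)) : Prop :=
  LowStack S T ∧ ∃ t, GRun M N p S t ∧ GRun M N p T t

theorem PairRun.next {I J : OInst L} {S T : List (OInst L)} {t₁ t₂ : Trace L} {σ τ : Config L}
    (h : PairRun M N p (I :: S) (J :: T)) (he : Enabled (I :: S)) (hs : NSStep p I.conf t₁ σ)
    (ht : NSStep p J.conf t₂ τ) :
    t₁ = t₂ ∧ σ.pcv = τ.pcv ∧ PairRun M N p (nextStack M N p I σ S) (nextStack M N p J τ T) := by
  obtain ⟨hl, t, r₁, r₂⟩ := h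
  have h' := (List.forall₂_cons.1 hl).1
  obtain ⟨u₁, e₁, r₁⟩ := r₁.of_step (.step he hs)
  obtain ⟨u₂, e₂, r₂⟩ := r₂.of_step (.step (hl.enabled he) ht)
  rw [e₁, List.append_assoc, List.append_assoc] at e₂
  -- Both instances are at the same instruction, so the equal traces begin with blocks of equal
  -- length.
  obtain ⟨rfl, e⟩ := List.append_inj e₂ (by rw [hs.length_eq, ht.length_eq, h'.pc])
  have hpc := hs.pc_congr ht h'.pc
  rw [h'.ctr, h'.pc, h'.rsb, hpc] at e
  obtain rfl := List.append_cancel_left e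
  exact ⟨rfl, hpc, hl.nextStack hpc, _, r₁, r₂⟩

theorem PairRun.rollback {I₁ I₂ J₁ J₂ : OInst L} {S T : List (OInst L)}
    (h : PairRun M N p (I₁ :: J₁ :: S) (I₂ :: J₂ :: T))
    (hI : I₁.win = 0 ∨ Enabled (I₁ :: J₁ :: S) ∧ Stuck p I₁.conf) :
    ∃ c, PairRun M N p ({ J₁ with ctr := c } :: S) ({ J₂ with ctr := c } :: T) := by
  obtain ⟨hl, t, r₁, r₂⟩ := h
  obtain ⟨h', hl'⟩ := List.forall₂_cons.1 hl
  obtain ⟨h'', hl''⟩ := List.forall₂_cons.1 hl'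
  have h₁ : GStep M N p (I₁ :: J₁ :: S) [.rollback J₁.ctr] ({ J₁ with ctr := I₁.ctr } :: S) := by
    rcases hI with hI | ⟨he, hI⟩
    · exact .rollback (by rw [popZero, if_pos hI])
    · exact .stuck he hI
  have h₂ : GStep M N p (I₂ :: J₂ :: T) [.rollback J₂.ctr] ({ J₂ with ctr := I₂.ctr } :: T) := by
    rcases hI with hI | ⟨he, hI⟩
    · exact .rollback (by rw [popZero, if_pos (h'.win ▸ hI)])
    · exact .stuck (hl.enabled he) (hI.of_pc_eq h'.pc)
  obtain ⟨u₁, e₁, r₁⟩ := r₁.of_step h₁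
  obtain ⟨u₂, e₂, r₂⟩ := r₂.of_step h₂
  rw [e₁, h''.ctr] at e₂
  obtain rfl := List.append_cancel_left e₂
  rw [← h'.ctr] at r₂
  exact ⟨_, .cons (h''.setCtr _) hl'', _, r₁, r₂⟩

theorem WinMono.next {I : OInst L} {S : List (OInst L)} (h : WinMono (I :: S)) {t : Trace L}
    {σ' : Config L} (hI : I.win ≠ 0) (s : NSStep p I.conf t σ') :
    WinMono (nextStack (none : Option (RetOracle L ω)) N p I σ' S) :=
  (GStep.step (N := N) (h.enabled hI) s).wellFormed (M := (none : Option (RetOracle L ω)))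
    (fun _ => h) rfl

/-- In the always-mispredict semantics, the two runs return together from a transaction. -/
theorem PairRun.pop {I₁ I₂ J₁ J₂ : OInst L} {S T : List (OInst L)}
    (h : PairRun (none : Option (RetOracle L ω)) N p (I₁ :: J₁ :: S) (I₂ :: J₂ :: T))
    (hm : WinMono (I₁ :: J₁ :: S)) (hI : I₁.win ≠ ⊤) :
    ∃ c, PairRun (none : Option (RetOracle L ω)) N p
      ({ J₁ with ctr := c } :: S) ({ J₂ with ctr := c } :: T) := by
  generalize hn : I₁.win = n at hI
  -- Induction on the top window, for all stacks at once: every instruction lowers it, and so does a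
  -- misprediction for both instances it produces.
  induction n using WellFoundedLT.induction generalizing I₁ I₂ J₁ J₂ S T with
  | ind n ih =>
    by_cases h0 : I₁.win = 0
    · exact h.rollback (.inl h0)
    by_cases hs : Stuck p I₁.conf
    · exact h.rollback (.inr ⟨hm.enabled h0, hs⟩)
    obtain ⟨t, σ, s⟩ := not_not.1 hs
    have hl := (List.forall₂_cons.1 h.1).1
    obtain ⟨t', τ, s'⟩ := s.exists_of_pc_eq hl.pc
    obtain ⟨rfl, hpc, h⟩ := h.next (hm.enabled h0) s s'
    have hm := hm.next (ω := ω) (N := N) h0 s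
    have hlt := (tick_lt (p := p) (v := I₁.conf.pcv) h0 (hn ▸ hI)).trans_eq hn
    have htop : tick p I₁.conf.pcv I₁.win ≠ ⊤ := hlt.ne_top
    cases hp : mispredicted p I₁.conf.pcv σ.pcv I₁.rsb with
    | none =>
      have hp' := hp
      rw [hl.pc, hl.rsb, hpc] at hp'
      rw [nextStack_none hp] at h hm
      rw [nextStack_none hp', map_lowerInst_none, map_lowerInst_none] at h
      rw [map_lowerInst_none] at hm
      exact ih _ hlt h hm rfl htop
    | some l =>
      have hp' := hp
      rw [hl.pc, hl.rsb, hpc] at hp'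
      rw [nextStack_some hp] at h hm
      rw [nextStack_some hp', map_lowerInst_none, map_lowerInst_none] at h
      rw [map_lowerInst_none] at hm
      -- A nested transaction: the induction hypothesis first removes the predicted instance, then
      -- the instance that continues at the actual address.
      obtain ⟨c, h⟩ := ih _ ((min_le_right _ _).trans_lt hlt) h hm rfl
        (ne_top_of_le_ne_top htop (min_le_right _ _))
      exact ih _ hlt h hm.2 rfl htop

section Reach

variable {ρ₁ ρ₂ σ₁ σ₂ : Config L} {R : List ℕ} {w : ℕ∞} {q : List Bool}

/-- The runs are followed along the path. A decision for the prediction leads to the new top; a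
decision for the actual return is reached by letting both runs finish the transaction with
`PairRun.pop`. -/
theorem PairReach.exists_pairRun (h : PairReach ω N p ρ₁ ρ₂ σ₁ σ₂ R w q)
    (h₀ : PairRun (none : Option (RetOracle L ω)) N p [.init ρ₁] [.init ρ₂]) :
    ∃ I J S T, PairRun (none : Option (RetOracle L ω)) N p (I :: S) (J :: T) ∧
      WinMono (I :: S) ∧ I.conf = σ₁ ∧ J.conf = σ₂ ∧ I.rsb = R ∧ I.win = w := by
  induction h with
  | init => exact ⟨_, _, [], [], h₀, ⟨by simp [budget], trivial⟩, rfl, rfl, rfl, rfl⟩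
  | step _ hw s₁ s₂ hp ih =>
    obtain ⟨I, J, S, T, h, hm, rfl, rfl, rfl, rfl⟩ := ih
    have hl := (List.forall₂_cons.1 h.1).1
    obtain ⟨-, hpc, h⟩ := h.next (hm.enabled hw) s₁ s₂
    have hm := hm.next (ω := ω) (N := N) hw s₁
    have hp' := hp
    rw [hl.pc, hl.rsb, hpc] at hp'
    rw [nextStack_none hp] at h hm
    rw [nextStack_none hp'] at h
    exact ⟨_, _, _, _, h, hm, rfl, rfl, rfl, rfl⟩
  | actual _ hw s₁ s₂ hp ih =>
    obtain ⟨I, J, S, T, h, hm, rfl, rfl, rfl, rfl⟩ := ih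
    have hl := (List.forall₂_cons.1 h.1).1
    obtain ⟨-, hpc, h⟩ := h.next (hm.enabled hw) s₁ s₂
    have hm := hm.next (ω := ω) (N := N) hw s₁
    have hp' := hp
    rw [hl.pc, hl.rsb, hpc] at hp'
    rw [nextStack_some hp] at h hm
    rw [nextStack_some hp'] at h
    obtain ⟨c, h⟩ := h.pop hm (by simp [newWin])
    exact ⟨_, _, _, _, h, hm.2, rfl, rfl, rfl, rfl⟩
  | predicted _ hw s₁ s₂ hp ih =>
    obtain ⟨I, J, S, T, h, hm, rfl, rfl, rfl, rfl⟩ := ih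
    have hl := (List.forall₂_cons.1 h.1).1
    obtain ⟨-, hpc, h⟩ := h.next (hm.enabled hw) s₁ s₂
    have hm := hm.next (ω := ω) (N := N) hw s₁
    have hp' := hp
    rw [hl.pc, hl.rsb, hpc] at hp'
    rw [nextStack_some hp] at h hm
    rw [nextStack_some hp'] at h
    exact ⟨_, _, _, _, h, hm, rfl, rfl, rfl, rfl⟩

theorem pathsAgree_of_pairRun
    (h₀ : PairRun (none : Option (RetOracle L ω)) N p [.init ρ₁] [.init ρ₂]) :
    PathsAgree ω N p ρ₁ ρ₂ := by
  intro σ₁ σ₂ R w q t₁ t₂ σ₁' σ₂' h hw s₁ s₂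
  obtain ⟨I, J, S, T, h', hm, rfl, rfl, rfl, rfl⟩ := h.exists_pairRun h₀
  exact (h'.next (hm.enabled hw) s₁ s₂).1

/-- The oracle that speculates, for `ω` steps, exactly along the path `q`. -/
def pathOracle (L : Lang) (ω : ℕ) (q : List Bool) : RetOracle L ω where
  window _ h _ := if q[h.length]? = some true then ω else 0
  window_le _ _ _ := by split_ifs <;> simp

/-- The history grows by one entry per misprediction, so its length is the index of the next
decision. The budget, not the top window, equals the path window: the oracle grants a full `ω`, and
the charged windows below supply the minimum with what remained. -/
theorem PairReach.exists_pairRun_oracle (h : PairReach ω N p ρ₁ ρ₂ σ₁ σ₂ R w q)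
    {q' : List Bool} (hq : q <+: q')
    (h₀ : PairRun (some (pathOracle L ω q')) N p [.init ρ₁] [.init ρ₂]) :
    ∃ I J S T, PairRun (some (pathOracle L ω q')) N p (I :: S) (J :: T) ∧
      budget (I :: S) = w ∧ I.conf = σ₁ ∧ J.conf = σ₂ ∧ I.rsb = R ∧
      I.hist.length = q.length := by
  have wf (S : List (OInst L)) : WellFormed (some (pathOracle L ω q')) S := by
    simp [WellFormed]
  have hnext (a : List Bool) (b : Bool) (h : a ++ [b] <+: q') : q'[a.length]? = some b := by
    obtain ⟨u, rfl⟩ := h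
    simp
  induction h with
  | init => exact ⟨_, _, [], [], h₀, by simp [budget, OInst.init], rfl, rfl, rfl, rfl⟩
  | step _ hw s₁ s₂ hp ih =>
    obtain ⟨I, J, S, T, h, rfl, rfl, rfl, rfl, hh⟩ := ih hq
    have hl := (List.forall₂_cons.1 h.1).1
    obtain ⟨-, hpc, h⟩ := h.next (enabled_iff.2 hw) s₁ s₂
    have hp' := hp
    rw [hl.pc, hl.rsb, hpc] at hp'
    rw [nextStack_none hp, nextStack_none hp'] at h
    exact ⟨_, _, _, _, h, (wf _).budget_next _, rfl, rfl, rfl, hh⟩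
  | actual _ hw s₁ s₂ hp ih =>
    obtain ⟨I, J, S, T, h, rfl, rfl, rfl, rfl, hh⟩ := ih ((List.prefix_append _ _).trans hq)
    have hl := (List.forall₂_cons.1 h.1).1
    obtain ⟨-, hpc, h⟩ := h.next (enabled_iff.2 hw) s₁ s₂
    have hp' := hp
    rw [hl.pc, hl.rsb, hpc] at hp'
    rw [nextStack_some hp, nextStack_some hp'] at h
    -- The next decision is `false`, so the oracle answers `0` and the transaction is rolled back at
    -- once.
    obtain ⟨c, h⟩ := h.rollback (.inl (by simp [newWin, pathOracle, hh, hnext _ _ hq]))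
    exact ⟨_, _, _, _, h, (wf _).budget_next _, rfl, rfl, rfl, by simp [hh]⟩
  | predicted _ hw s₁ s₂ hp ih =>
    obtain ⟨I, J, S, T, h, rfl, rfl, rfl, rfl, hh⟩ := ih ((List.prefix_append _ _).trans hq)
    have hl := (List.forall₂_cons.1 h.1).1
    obtain ⟨-, hpc, h⟩ := h.next (enabled_iff.2 hw) s₁ s₂
    have hp' := hp
    rw [hl.pc, hl.rsb, hpc] at hp'
    rw [nextStack_some hp, nextStack_some hp'] at h
    refine ⟨_, _, _, _, h, ?_, rfl, rfl, rfl, by simp [hh]⟩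
    -- The next decision is `true`, so the new window is `ω`; the rest of the stack has budget
    -- `tick` of the old budget.
    rw [← (wf _).budget_next]
    simp [newWin, pathOracle, hh, hnext _ _ hq, budget]

theorem pathsAgree_of_pairRun_oracle
    (h₀ : ∀ q, PairRun (some (pathOracle L ω q)) N p [.init ρ₁] [.init ρ₂]) :
    PathsAgree ω N p ρ₁ ρ₂ := by
  intro σ₁ σ₂ R w q t₁ t₂ σ₁' σ₂' h hw s₁ s₂
  obtain ⟨I, J, S, T, h', rfl, rfl, rfl, rfl, -⟩ :=
    h.exists_pairRun_oracle (List.prefix_refl q) (h₀ q)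
  exact (h'.next (enabled_iff.2 hw) s₁ s₂).1

end Reach

/-! ### Over-approximation of the oracle semantics -/

/-- If equal traces in the modes `M` imply agreement along all paths, then speculative
non-interference in these modes implies it in every mode. -/
theorem sni_of_sni {ι : Type} {P : Policy L} {M : ι → Option (RetOracle L ω)}
    {T : ι → Config L → Trace L → Prop} {T' : Config L → Trace L → Prop}
    (M' : Option (RetOracle L ω)) (hT : ∀ i σ t, T i σ t ↔ GRun (M i) N p [.init σ] t)
    (hT' : ∀ σ t, T' σ t ↔ GRun M' N p [.init σ] t)
    (ha : ∀ σ₁ σ₂, (∀ i, PairRun (M i) N p [.init σ₁] [.init σ₂]) → PathsAgree ω N p σ₁ σ₂)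
    (h : ∀ i, SNI P p (T i)) : SNI P p T' := by
  intro σ₁ σ₂ i₁ i₂ hP t₁ t₂ r₁ r₂ hns
  rw [hT'] at r₁ r₂
  have hpc : σ₁.pcv = σ₂.pcv := i₁.trans i₂.symm
  refine (ha σ₁ σ₂ fun i => ⟨.cons ⟨rfl, rfl, rfl, rfl, hpc⟩ .nil, ?_⟩).eq_of_gRun hpc r₁ r₂
  -- The other mode has terminating runs from the same configurations, with the same projections as
  -- the given traces; non-interference there makes them equal.
  obtain ⟨u₁, h₁, e₁⟩ := r₁.nsTrace.exists_nsProj_eq (M i) N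
  obtain ⟨u₂, h₂, e₂⟩ := r₂.nsTrace.exists_nsProj_eq (M i) N
  obtain rfl := h i σ₁ σ₂ i₁ i₂ hP u₁ u₂ ((hT _ _ _).2 h₁) ((hT _ _ _).2 h₂)
    (e₁.trans (hns.trans e₂.symm))
  exact ⟨_, h₁, h₂⟩

theorem forall_oracle_sni_iff (P : Policy L) (p : Program L) :
    (∀ O : RetOracle L ω, SNI P p (OTrace N O p)) ↔ SNI P p (AMTrace ω N p) := by
  constructor
  · intro h
    exact sni_of_sni (M := fun q => some (pathOracle L ω q)) none (fun _ => oTrace_iff _)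
      amTrace_iff (fun _ _ => pathsAgree_of_pairRun_oracle) fun _ => h _
  · intro h O
    exact sni_of_sni (M := fun _ : Unit => none) (some O) (fun _ => amTrace_iff) (oTrace_iff O)
      (fun _ _ h => pathsAgree_of_pairRun (h ())) fun _ => h

variable {μ : Valuation L}

/-! ### The symbolic semantics -/

/-- The valuation `μ` satisfies the path condition of `t`. -/
def Sat (μ : Valuation L) (t : STrace L) : Prop := ∀ φ, SObs.cond φ ∈ t → φ.Holds μ

theorem sat_append {t u : STrace L} : Sat μ (t ++ u) ↔ Sat μ t ∧ Sat μ u := by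
  simp [Sat, or_imp, forall_and]

noncomputable def SConfig.conc (μ : Valuation L) (s : SConfig L) : Config L :=
  ⟨s.mem.eval μ, fun x => (s.reg x).eval μ⟩

theorem eval_setReg (a : Reg L → SExpr L) (x : Reg L) (e : SExpr L) :
    (fun y => (setReg a x e y).eval μ) = setReg (fun y => (a y).eval μ) x (e.eval μ) := by
  funext y
  by_cases h : y = x
  · subst h; simp [setReg_same]
  · simp [setReg_of_ne, h]

theorem Expr.eval_seval (a : Reg L → SExpr L) (e : Expr L) :
    (e.seval a).eval μ = e.eval fun x => (a x).eval μ := by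
  induction e with
  | val v => rfl
  | reg x => rfl
  | un o e ih => simp [Expr.seval, Expr.eval, SExpr.eval, ih]
  | bin o e₁ e₂ ih₁ ih₂ => simp [Expr.seval, Expr.eval, SExpr.eval, ih₁, ih₂]

theorem SExpr.eval_val (v : Val) : (SExpr.val v : SExpr L).eval μ = v := by rw [SExpr.eval]

theorem SConfig.conc_pcv {s : SConfig L} {v : Val} (h : s.reg .pc = .val v) :
    (s.conc μ).pcv = v := by
  simp [SConfig.conc, Config.pcv, h, SExpr.eval_val]

theorem SNSStep.exists_pc {s s' : SConfig L} {t : STrace L} (h : SNSStep p s t s') :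
    ∃ v, s'.reg .pc = .val v := by
  cases h <;> exact ⟨_, setReg_same _ _ _⟩

theorem setReg_self {α : Type} (a : Reg L → α) (x : Reg L) : setReg a x (a x) = a := by
  simp [setReg]

theorem SNSStep.nsStep {s s' : SConfig L} {t : STrace L} (h : SNSStep p s t s') (ht : Sat μ t) :
    NSStep p (s.conc μ) (t.filterMap (SObs.conc μ)) (s'.conc μ) := by
  have hpc {a : Reg L → SExpr L} {n : ℕ} (h : a .pc = .val (some n)) :
      (fun x => (a x).eval μ) .pc = some n := by simp [h, SExpr.eval_val]
  cases h with
  | skip h₁ h₂ =>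
    simpa [SConfig.conc, eval_setReg, SExpr.eval_val] using NSStep.skip (hpc h₁) h₂
  | barrier h₁ h₂ =>
    simpa [SConfig.conc, eval_setReg, SExpr.eval_val] using NSStep.barrier (hpc h₁) h₂
  | assign h₁ h₂ h₃ =>
    simpa [SConfig.conc, eval_setReg, SExpr.eval_val, Expr.eval_seval] using
      NSStep.assign (hpc h₁) h₂ h₃
  | @cmov m a n x e c h₁ h₂ h₃ =>
    by_cases hc : c.eval (fun x => (a x).eval μ) = some 0
    · simpa [SConfig.conc, eval_setReg, SExpr.eval_val, Expr.eval_seval, SExpr.eval, hc] using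
        NSStep.cmovSat (hpc h₁) h₂ h₃ hc
    -- The symbolic rule always writes; if the condition fails, it writes back the old content,
    -- which changes nothing.
    · simpa [SConfig.conc, eval_setReg, SExpr.eval_val, Expr.eval_seval, SExpr.eval, hc,
        setReg_self (fun y => (a y).eval μ)] using
        NSStep.cmovUnsat (hpc h₁) h₂ h₃ hc
  | load h₁ h₂ h₃ =>
    simpa [SConfig.conc, eval_setReg, SExpr.eval_val, Expr.eval_seval, SExpr.eval, SObs.conc]
      using NSStep.load (hpc h₁) h₂ h₃
  | store h₁ h₂ =>
    simpa [SConfig.conc, eval_setReg, SExpr.eval_val, Expr.eval_seval, SMem.eval, SObs.conc]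
      using NSStep.store (hpc h₁) h₂
  | @jmp m a n e l h₁ h₂ =>
    -- The path condition identifies the guessed target `l` with the value of the jump expression.
    have hc := ht _ List.mem_cons_self
    simp only [PathCond.Holds, Expr.eval_seval] at hc
    simpa [SConfig.conc, eval_setReg, SExpr.eval_val, SObs.conc, List.filterMap_cons, hc] using
      NSStep.jmp (m := m.eval μ) (a := fun x => (a x).eval μ) (hpc h₁) h₂
  | @beqzSat m a n x _ h₁ h₂ =>
    simpa [SConfig.conc, eval_setReg, SExpr.eval_val, SObs.conc, List.filterMap_cons] using
      NSStep.beqzSat (m := m.eval μ) (a := fun x => (a x).eval μ) (hpc h₁) h₂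
        (ht _ List.mem_cons_self)
  | @beqzUnsat m a n x _ h₁ h₂ =>
    simpa [SConfig.conc, eval_setReg, SExpr.eval_val, SObs.conc, List.filterMap_cons] using
      NSStep.beqzUnsat (m := m.eval μ) (a := fun x => (a x).eval μ) (hpc h₁) h₂
        (ht _ List.mem_cons_self)
  | call h₁ h₂ h₃ =>
    simpa [SConfig.conc, eval_setReg, SExpr.eval_val, SObs.conc, SMem.eval, SExpr.eval] using
      NSStep.call (hpc h₁) h₂ h₃
  | @ret m a n l h₁ h₂ =>
    have hc := ht _ List.mem_cons_self
    simp only [PathCond.Holds, SExpr.eval] at hc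
    simpa [SConfig.conc, eval_setReg, SExpr.eval, SObs.conc, List.filterMap_cons, hc] using
      NSStep.ret (m := m.eval μ) (a := fun x => (a x).eval μ) (hpc h₁) h₂
  | terminate h₁ h₂ =>
    simpa [SConfig.conc, eval_setReg, SExpr.eval_val, SObs.conc, List.filterMap_cons] using
      NSStep.terminate (hpc h₁) h₂

/-- Up to the choice of the path condition, there is a symbolic step for every concrete step. -/
theorem NSStep.exists_snsStep {s : SConfig L} {σ' : Config L} {t : Trace L} {v : Val}
    (h : NSStep p (s.conc μ) t σ') (hv : s.reg .pc = .val v) :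
    ∃ t' s', SNSStep p s t' s' ∧ Sat μ t' ∧ t'.filterMap (SObs.conc μ) = t ∧
      s'.conc μ = σ' := by
  -- Any symbolic step with satisfied conditions will do: it concretises to a step from the same
  -- configuration, and concrete steps are deterministic.
  suffices ∃ t' s', SNSStep p s t' s' ∧ Sat μ t' by
    obtain ⟨t', s', hs, ht⟩ := this
    obtain ⟨e₁, e₂⟩ := (hs.nsStep ht).det h
    exact ⟨t', s', hs, ht, e₁, e₂⟩
  have hpc {n : ℕ} (h : (s.conc μ).reg .pc = some n) : s.reg .pc = .val (some n) := by
    rw [hv, ← h, ← SConfig.conc_pcv (μ := μ) hv]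
  obtain ⟨m, a⟩ := s
  have nil : Sat μ ([] : STrace L) := by simp [Sat]
  generalize hσ : SConfig.conc μ ⟨m, a⟩ = σ at h
  cases h with
  | skip h₁ h₂ => exact ⟨_, _, .skip (hpc (hσ ▸ h₁)) h₂, nil⟩
  | barrier h₁ h₂ => exact ⟨_, _, .barrier (hpc (hσ ▸ h₁)) h₂, nil⟩
  | assign h₁ h₂ h₃ => exact ⟨_, _, .assign (hpc (hσ ▸ h₁)) h₂ h₃, nil⟩
  | cmovSat h₁ h₂ h₃ => exact ⟨_, _, .cmov (hpc (hσ ▸ h₁)) h₂ h₃, nil⟩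
  | cmovUnsat h₁ h₂ h₃ => exact ⟨_, _, .cmov (hpc (hσ ▸ h₁)) h₂ h₃, nil⟩
  | load h₁ h₂ h₃ => exact ⟨_, _, .load (hpc (hσ ▸ h₁)) h₂ h₃, by simp [Sat]⟩
  | store h₁ h₂ => exact ⟨_, _, .store (hpc (hσ ▸ h₁)) h₂, by simp [Sat]⟩
  | @jmp _ a' _ e h₁ h₂ =>
    -- The target to guess is the value under `μ`, which satisfies the path condition by
    -- reflexivity.
    refine ⟨_, _, .jmp ((e.seval a).eval μ) (hpc (hσ ▸ h₁)) h₂, by simp [Sat, PathCond.Holds]⟩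
  | @beqzSat _ a' _ x _ h₁ h₂ h₃ =>
    refine ⟨_, _, .beqzSat (hpc (hσ ▸ h₁)) h₂, ?_⟩
    simp only [SConfig.conc, Config.mk.injEq] at hσ
    simpa [Sat, PathCond.Holds, ← hσ.2] using h₃
  | @beqzUnsat _ a' _ x _ h₁ h₂ h₃ =>
    refine ⟨_, _, .beqzUnsat (hpc (hσ ▸ h₁)) h₂, ?_⟩
    simp only [SConfig.conc, Config.mk.injEq] at hσ
    simpa [Sat, PathCond.Holds, ← hσ.2] using h₃
  | call h₁ h₂ h₃ => exact ⟨_, _, .call (hpc (hσ ▸ h₁)) h₂ h₃, by simp [Sat]⟩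
  | ret h₁ h₂ =>
    exact ⟨_, _, .ret ((SExpr.read m (a .sp)).eval μ) (hpc (hσ ▸ h₁)) h₂,
      by simp [Sat, PathCond.Holds]⟩
  | terminate h₁ h₂ => exact ⟨_, _, .terminate (hpc (hσ ▸ h₁)) h₂, by simp [Sat]⟩

theorem SNSStep.exists_nsStep {s s' : SConfig L} {t : STrace L} (h : SNSStep p s t s')
    (μ : Valuation L) : ∃ t' σ', NSStep p (s.conc μ) t' σ' := by
  have hpc {a : Reg L → SExpr L} {n : ℕ} (h : a .pc = .val (some n)) :
      (fun x => (a x).eval μ) .pc = some n := by simp [h, SExpr.eval_val]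
  cases h with
  | skip h₁ h₂ => exact ⟨_, _, .skip (hpc h₁) h₂⟩
  | barrier h₁ h₂ => exact ⟨_, _, .barrier (hpc h₁) h₂⟩
  | assign h₁ h₂ h₃ => exact ⟨_, _, .assign (hpc h₁) h₂ h₃⟩
  | @cmov _ a _ _ _ c h₁ h₂ h₃ =>
    by_cases h : c.eval (fun x => (a x).eval μ) = some 0
    · exact ⟨_, _, .cmovSat (hpc h₁) h₂ h₃ h⟩
    · exact ⟨_, _, .cmovUnsat (hpc h₁) h₂ h₃ h⟩
  | load h₁ h₂ h₃ => exact ⟨_, _, .load (hpc h₁) h₂ h₃⟩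
  | store h₁ h₂ => exact ⟨_, _, .store (hpc h₁) h₂⟩
  | jmp l h₁ h₂ => exact ⟨_, _, .jmp (hpc h₁) h₂⟩
  | @beqzSat _ a _ x _ h₁ h₂ | @beqzUnsat _ a _ x _ h₁ h₂ =>
    by_cases h : (fun x => (a x).eval μ) x = some 0
    · exact ⟨_, _, .beqzSat (hpc h₁) h₂ h⟩
    · exact ⟨_, _, .beqzUnsat (hpc h₁) h₂ h⟩
  | call h₁ h₂ h₃ => exact ⟨_, _, .call (hpc h₁) h₂ h₃⟩
  | ret l h₁ h₂ => exact ⟨_, _, .ret (hpc h₁) h₂⟩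
  | terminate h₁ h₂ => exact ⟨_, _, .terminate (hpc h₁) h₂⟩

/-- Stuckness depends only on the program counter, which is concrete, so the valuation is
irrelevant. Symbolic and concrete rollbacks therefore occur together. -/
theorem sStuck_iff {s : SConfig L} {v : Val} (hv : s.reg .pc = .val v) :
    SStuck p s ↔ Stuck p (s.conc μ) := by
  refine not_congr ⟨fun ⟨_, _, h⟩ => h.exists_nsStep μ, fun ⟨_, _, h⟩ => ?_⟩
  obtain ⟨t, s', h, -⟩ := h.exists_snsStep hv
  exact ⟨t, s', h⟩

-- Symbolic always-mispredict steps

noncomputable def SConfig.predict (s : SConfig L) (l : ℕ) : SConfig L :=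
  ⟨s.mem, setReg (setReg s.reg .sp (.add8 (s.reg .sp))) .pc (.val (some l))⟩

theorem SConfig.conc_predict (s : SConfig L) (l : ℕ) :
    (s.predict l).conc μ = (s.conc μ).predict l := by
  simp [SConfig.predict, SConfig.conc, Config.predict, eval_setReg, SExpr.eval]

def sspecObs (c : ℕ) : Option ℕ → STrace L
  | none => []
  | some l => [.start c, .ret (some l)]

theorem sat_sspecObs (c : ℕ) (s : Option ℕ) : Sat μ (sspecObs c s) := by
  cases s <;> simp [Sat, sspecObs]

theorem conc_sspecObs (c : ℕ) (s : Option ℕ) :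
    (sspecObs c s).filterMap (SObs.conc μ) = specObs c s := by
  cases s <;> simp [sspecObs, specObs, SObs.conc]

/-- The stack after a step of the instance `I` to `s'`, where the program counter changes from `v`
to `v'`. -/
noncomputable def samNext (ω N : ℕ) (p : Program L) (v v' : Val) (I : SInst L) (s' : SConfig L)
    (S : List (SInst L)) : List (SInst L) :=
  match mispredicted p v v' I.rsb with
  | none => ⟨I.ctr, s', rsbNext N p v I.rsb, tick p v I.win⟩ :: S
  | some l =>
      ⟨I.ctr + 1, I.conf.predict l, rsbNext N p v I.rsb, min (ω : ℕ∞) (tick p v I.win)⟩ ::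
      ⟨I.ctr, s', rsbNext N p v I.rsb, tick p v I.win⟩ :: S

theorem samNext_none {v v' : Val} {I : SInst L} {s' : SConfig L} {S : List (SInst L)}
    (h : mispredicted p v v' I.rsb = none) :
    samNext ω N p v v' I s' S = ⟨I.ctr, s', rsbNext N p v I.rsb, tick p v I.win⟩ :: S := by
  simp [samNext, h]

theorem samNext_some {v v' : Val} {I : SInst L} {s' : SConfig L} {S : List (SInst L)} {l : ℕ}
    (h : mispredicted p v v' I.rsb = some l) :
    samNext ω N p v v' I s' S =
      ⟨I.ctr + 1, I.conf.predict l, rsbNext N p v I.rsb, min (ω : ℕ∞) (tick p v I.win)⟩ ::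
      ⟨I.ctr, s', rsbNext N p v I.rsb, tick p v I.win⟩ :: S := by
  simp [samNext, h]

theorem exists_eq_some_of_instrAt {v : Val} {i : Instr L} (h : p.instrAt v = some i) : ∃ k, v = some k := by
  cases v with
  | none => simp [Program.instrAt] at h
  | some k => exact ⟨k, rfl⟩

theorem SAMStep.of_snsStep {I : SInst L} {s' : SConfig L} {S : List (SInst L)} {t : STrace L}
    {v v' : Val} (hw : I.win ≠ 0) (s : SNSStep p I.conf t s') (hv : I.conf.reg .pc = .val v)
    (hv' : s'.reg .pc = .val v') :
    SAMStep ω N p (I :: S) (t ++ sspecObs I.ctr (mispredicted p v v' I.rsb))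
      (samNext ω N p v v' I s' S) := by
  obtain ⟨c, σ, R, w⟩ := I
  dsimp only at s hv hw ⊢
  have hw' := ENat.exists_eq_add_one hw
  by_cases hr : p.instrAt v = some .ret
  · have hb := hr.trans_ne (by simp : _ ≠ some .barrier)
    cases R with
    | nil =>
      rw [mispredicted_nil, sspecObs, List.append_nil, samNext_none (mispredicted_nil _ _)]
      rw [rsbNext_ret hr, tick_of_not_barrier hb]
      exact .retEmpty hw' s hv hr
    | cons l R =>
      by_cases hl : some l = v'
      · subst hl
        rw [samNext_none (mispredicted_same _ _), mispredicted_same, sspecObs, List.append_nil]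
        rw [rsbNext_ret hr, tick_of_not_barrier hb]
        exact .retSame hw' s hv hr hv'
      · rw [samNext_some (mispredicted_cons hr hl), mispredicted_cons hr hl]
        rw [rsbNext_ret hr, tick_of_not_barrier hb]
        exact .retSpec hw' s hv hr (by simpa [hv'] using Ne.symm hl)
  · rw [samNext_none (mispredicted_other hr), mispredicted_other hr, sspecObs, List.append_nil]
    by_cases hb : p.instrAt v = some .barrier
    · rw [rsbNext_other hr (by simp [hb]), tick, if_pos hb]
      dsimp only
      split_ifs with h
      · subst h; exact .barrier s hv hb
      · exact .barrierSpec hw h s hv hb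
    · rw [tick_of_not_barrier hb]
      by_cases hc : ∃ f, p.instrAt v = some (.call f)
      · obtain ⟨f, hc⟩ := hc
        rw [rsbNext_call hc]
        obtain ⟨k, rfl⟩ := exists_eq_some_of_instrAt hc
        split_ifs with hN
        · exact .call hw' s hv hc hN
        · exact .callFull hw' s hv hc (not_lt.1 hN)
      · rw [rsbNext_other hr (not_exists.1 hc)]
        exact .noSpec hw' s hv hb hr (not_exists.1 hc)

theorem SAMStep.of_snsStep_none {I : SInst L} {s' : SConfig L} {S S' : List (SInst L)}
    {t : STrace L} {v v' : Val} (s : SNSStep p I.conf t s') (hv : I.conf.reg .pc = .val v)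
    (hv' : s'.reg .pc = .val v') (h : mispredicted p v v' I.rsb = none)
    (hS : S' = ⟨I.ctr, s', rsbNext N p v I.rsb, tick p v I.win⟩ :: S) :
    ∃ t₀ s'' v v', SNSStep p I.conf t₀ s'' ∧ I.conf.reg .pc = .val v ∧ s''.reg .pc = .val v' ∧
        t = t₀ ++ sspecObs I.ctr (mispredicted p v v' I.rsb) ∧
        S' = samNext ω N p v v' I s'' S :=
  ⟨t, s', v, v', s, hv, hv', by simp [h, sspecObs], by rw [samNext_none h, hS]⟩

theorem SAMStep.cases_top {I : SInst L} {S S' : List (SInst L)} {t : STrace L}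
    (h : SAMStep ω N p (I :: S) t S') :
    (I.win ≠ 0 ∧ ∃ t₀ s' v v', SNSStep p I.conf t₀ s' ∧ I.conf.reg .pc = .val v ∧
        s'.reg .pc = .val v' ∧ t = t₀ ++ sspecObs I.ctr (mispredicted p v v' I.rsb) ∧
        S' = samNext ω N p v v' I s' S) ∨
      ∃ J S₀, S = J :: S₀ ∧ (I.win = 0 ∨ SStuck p I.conf) ∧ t = [.rollback J.ctr] ∧
        S' = { J with ctr := I.ctr } :: S₀ := by
  cases h with
  | noSpec hw s hv hb hr hc =>
    subst hw
    obtain ⟨v', hv'⟩ := s.exists_pc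
    refine .inl ⟨by simp, of_snsStep_none s hv hv' (mispredicted_other hr) ?_⟩
    rw [rsbNext_other hr hc, tick_of_not_barrier hb, ENat.add_one_sub_one]
  | barrier s hv hb =>
    obtain ⟨v', hv'⟩ := s.exists_pc
    refine .inl ⟨by simp, of_snsStep_none s hv hv' (mispredicted_other (by simp [hb])) ?_⟩
    rw [rsbNext_other (by simp [hb]) (by simp [hb]), tick_top]
  | barrierSpec hw h s hv hb =>
    obtain ⟨v', hv'⟩ := s.exists_pc
    refine .inl ⟨hw, of_snsStep_none s hv hv' (mispredicted_other (by simp [hb])) ?_⟩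
    rw [rsbNext_other (by simp [hb]) (by simp [hb]), tick, if_pos hb, if_neg h]
  | call hw s hv hc hN =>
    have hb := hc.trans_ne (by simp : _ ≠ some .barrier)
    subst hw
    obtain ⟨v', hv'⟩ := s.exists_pc
    refine .inl ⟨by simp, of_snsStep_none s hv hv' (mispredicted_other (by simp [hc])) ?_⟩
    rw [rsbNext_call hc, tick_of_not_barrier hb, ENat.add_one_sub_one, if_pos hN,
      Option.getD_some]
  | callFull hw s hv hc hN =>
    have hb := hc.trans_ne (by simp : _ ≠ some .barrier)
    subst hw
    obtain ⟨v', hv'⟩ := s.exists_pc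
    refine .inl ⟨by simp, of_snsStep_none s hv hv' (mispredicted_other (by simp [hc])) ?_⟩
    rw [rsbNext_call hc, tick_of_not_barrier hb, ENat.add_one_sub_one, if_neg (not_lt.2 hN)]
  | retEmpty hw s hv hr =>
    have hb := hr.trans_ne (by simp : _ ≠ some .barrier)
    subst hw
    obtain ⟨v', hv'⟩ := s.exists_pc
    refine .inl ⟨by simp, of_snsStep_none s hv hv' (mispredicted_nil _ _) ?_⟩
    rw [rsbNext_ret hr, tick_of_not_barrier hb, ENat.add_one_sub_one, List.tail_nil]
  | retSame hw s hv hr hl =>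
    have hb := hr.trans_ne (by simp : _ ≠ some .barrier)
    subst hw
    refine .inl ⟨by simp, of_snsStep_none s hv hl (mispredicted_same _ _) ?_⟩
    rw [rsbNext_ret hr, tick_of_not_barrier hb, ENat.add_one_sub_one, List.tail_cons]
  | @retSpec c l v σ σ' R _ _ _ S hw s hv hr hl =>
    have hb := hr.trans_ne (by simp : _ ≠ some .barrier)
    subst hw
    obtain ⟨v', hv'⟩ := s.exists_pc
    have hm : mispredicted p v v' (l :: R) = some l :=
      mispredicted_cons hr fun e => hl (by rw [hv', e])
    refine .inl ⟨by simp, _, _, v, v', s, hv, hv', by rw [hm]; rfl, ?_⟩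
    rw [samNext_some hm, rsbNext_ret hr, tick_of_not_barrier hb, ENat.add_one_sub_one,
      List.tail_cons]
    rfl
  | rollback h => exact .inr ⟨_, _, rfl, h, rfl, rfl⟩

/-- The program counters of all instances are concrete. -/
def PcConcrete (S : List (SInst L)) : Prop := ∀ I ∈ S, ∃ v, I.conf.reg .pc = .val v

theorem pcConcrete_cons {I : SInst L} {S : List (SInst L)} :
    PcConcrete (I :: S) ↔ (∃ v, I.conf.reg .pc = .val v) ∧ PcConcrete S := by
  simp [PcConcrete]

theorem PcConcrete.samNext {I : SInst L} {S : List (SInst L)} {s' : SConfig L} {v v' : Val}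
    (h : PcConcrete S) (hs : s'.reg .pc = .val v') :
    PcConcrete (samNext ω N p v v' I s' S) := by
  cases hm : mispredicted p v v' I.rsb with
  | none =>
    rw [samNext_none hm, pcConcrete_cons]
    exact ⟨⟨_, hs⟩, h⟩
  | some l =>
    rw [samNext_some hm, pcConcrete_cons, pcConcrete_cons]
    exact ⟨⟨_, setReg_same _ _ _⟩, ⟨_, hs⟩, h⟩

theorem SAMStep.pcConcrete {S S' : List (SInst L)} {t : STrace L} (h : SAMStep ω N p S t S')
    (hS : PcConcrete S) : PcConcrete S' := by
  cases S with
  | nil => cases h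
  | cons I S =>
    rw [pcConcrete_cons] at hS
    rcases h.cases_top with ⟨-, t₀, s', v, v', -, -, hv', -, rfl⟩ | ⟨J, S₀, rfl, -, -, rfl⟩
    · exact hS.2.samNext hv'
    · have := pcConcrete_cons.1 hS.2
      exact pcConcrete_cons.2 this

noncomputable def SInst.conc (μ : Valuation L) (I : SInst L) : Inst L :=
  ⟨I.ctr, I.conf.conc μ, I.rsb, I.win⟩

theorem map_conc_samNext {I : SInst L} {S : List (SInst L)} {s' : SConfig L} {v v' : Val}
    (hv : I.conf.reg .pc = .val v) (hv' : s'.reg .pc = .val v') :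
    (samNext ω N p v v' I s' S).map (SInst.conc μ) =
      amNext ω N p (I.conc μ) (s'.conc μ) (S.map (SInst.conc μ)) := by
  have e : (I.conc μ).conf.pcv = v := SConfig.conc_pcv hv
  have e' : (s'.conc μ).pcv = v' := SConfig.conc_pcv hv'
  unfold samNext amNext
  rw [e, e']
  change _ = match mispredicted p v v' I.rsb with | none => _ | some l => _
  split <;> simp [SInst.conc, SConfig.conc_predict]

theorem SAMStep.amStep {S S' : List (SInst L)} {t : STrace L} (h : SAMStep ω N p S t S')
    (hS : PcConcrete S) (ht : Sat μ t) :
    AMStep ω N p (S.map (SInst.conc μ)) (t.filterMap (SObs.conc μ)) (S'.map (SInst.conc μ)) := by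
  cases S with
  | nil => cases h
  | cons I S =>
    rcases h.cases_top with ⟨hw, t₀, s', v, v', s, hv, hv', rfl, rfl⟩ | ⟨J, S₀, rfl, hI, rfl, rfl⟩
    · rw [map_conc_samNext hv hv', List.filterMap_append, conc_sspecObs]
      have := AMStep.of_nsStep (ω := ω) (N := N) (I := I.conc μ) (S := S.map (SInst.conc μ)) hw
        (s.nsStep (sat_append.1 ht).1)
      rwa [SConfig.conc_pcv hv', show (I.conc μ).conf.pcv = v from SConfig.conc_pcv hv] at this
    · obtain ⟨v, hv⟩ := (pcConcrete_cons.1 hS).1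
      exact .rollback (hI.imp_right (sStuck_iff hv).1)

/-- Only the configurations are symbolic; counters, buffers and windows evolve identically once the
program counters before and after the step are known values. -/
theorem AMStep.exists_samStep {S : List (SInst L)} {U : List (Inst L)} {u : Trace L}
    (h : AMStep ω N p (S.map (SInst.conc μ)) u U) (hS : PcConcrete S) :
    ∃ t S', SAMStep ω N p S t S' ∧ Sat μ t ∧ t.filterMap (SObs.conc μ) = u ∧
      S'.map (SInst.conc μ) = U := by
  cases S with
  | nil => cases h
  | cons I S =>
    obtain ⟨v, hv⟩ := (pcConcrete_cons.1 hS).1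
    rcases h.cases_top with ⟨hw, t₀, σ', s, rfl, rfl⟩ | ⟨J, S₀, e, hI, rfl, rfl⟩
    · obtain ⟨t, s', hs, ht, rfl, rfl⟩ := NSStep.exists_snsStep s hv
      obtain ⟨v', hv'⟩ := hs.exists_pc
      refine ⟨_, _, .of_snsStep hw hs hv hv', sat_append.2 ⟨ht, sat_sspecObs _ _⟩, ?_,
        map_conc_samNext hv hv'⟩
      rw [List.filterMap_append, conc_sspecObs, SConfig.conc_pcv hv',
        show (I.conc μ).conf.pcv = v from SConfig.conc_pcv hv]
      rfl
    · cases S with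
      | nil => simp at e
      | cons K S =>
        simp only [List.map_cons, List.cons.injEq] at e
        obtain ⟨rfl, rfl⟩ := e
        refine ⟨_, _, .rollback (σ := K.conf) (hI.imp_right (sStuck_iff hv).2), by simp [Sat], ?_,
          rfl⟩
        simp [SObs.conc, SInst.conc]

-- Symbolic traces and their concretisations

theorem SConfig.conc_init (p : Program L) (μ : Valuation L) :
    (SConfig.init p).conc μ = ⟨μ.mem, setReg μ.reg .pc (some p.entry)⟩ := by
  simp [SConfig.conc, SConfig.init, eval_setReg, SExpr.eval, SMem.eval]

theorem pcConcrete_init (p : Program L) : PcConcrete [⟨0, SConfig.init p, [], ⊤⟩] :=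
  pcConcrete_cons.2 ⟨⟨_, setReg_same _ _ _⟩, by simp [PcConcrete]⟩

theorem SAMTrace.amTrace {t : STrace L} (h : SAMTrace ω N p t) (ht : Sat μ t) :
    AMTrace ω N p ((SConfig.init p).conc μ) (t.filterMap (SObs.conc μ)) := by
  obtain ⟨I, s, f⟩ := h
  refine ⟨I.conc μ, ?_, SConfig.conc_pcv f⟩
  suffices ∀ S t S', Steps (SAMStep ω N p) S t S' → PcConcrete S → Sat μ t →
      Steps (AMStep ω N p) (S.map (SInst.conc μ)) (t.filterMap (SObs.conc μ))
        (S'.map (SInst.conc μ)) from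
    this _ _ _ s (pcConcrete_init p) ht
  intro S t S' s
  induction s with
  | refl => exact fun _ _ => .refl _
  | head h _ ih =>
    intro hS ht
    rw [sat_append] at ht
    rw [List.filterMap_append]
    exact .head (h.amStep hS ht.1) (ih (h.pcConcrete hS) ht.2)

theorem AMTrace.exists_samTrace {u : Trace L}
    (h : AMTrace ω N p ((SConfig.init p).conc μ) u) :
    ∃ t, SAMTrace ω N p t ∧ Sat μ t ∧ u = t.filterMap (SObs.conc μ) := by
  obtain ⟨J, s, f⟩ := h
  suffices ∀ U u U', Steps (AMStep ω N p) U u U' → ∀ S, U = S.map (SInst.conc μ) →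
      PcConcrete S → ∃ t S', Steps (SAMStep ω N p) S t S' ∧ Sat μ t ∧
        u = t.filterMap (SObs.conc μ) ∧ U' = S'.map (SInst.conc μ) ∧ PcConcrete S' by
    obtain ⟨t, S', s', ht, e, e', hS'⟩ := this _ _ _ s [⟨0, SConfig.init p, [], ⊤⟩] rfl
      (pcConcrete_init p)
    obtain ⟨I, rfl, rfl⟩ := List.map_eq_singleton_iff.1 e'.symm
    obtain ⟨v, hv⟩ := (pcConcrete_cons.1 hS').1
    refine ⟨t, ⟨I, s', ?_⟩, ht, e⟩
    -- A final concrete configuration evaluates the program counter to `⊥`; since the symbolic one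
    -- is already a value, it is literally `⊥`.
    have : v = none := (SConfig.conc_pcv (μ := μ) hv).symm.trans f
    rwa [this] at hv
  intro U u U' s
  induction s with
  | refl => rintro _ rfl hS; exact ⟨[], _, .refl _, by simp [Sat], rfl, rfl, hS⟩
  | head h _ ih =>
    rintro S rfl hS
    obtain ⟨t, S', hs, ht, rfl, rfl⟩ := h.exists_samStep hS
    obtain ⟨t', S'', hs', ht', rfl, rfl, hS''⟩ := ih S' rfl (hs.pcConcrete hS)
    exact ⟨_, _, .head hs hs', sat_append.2 ⟨ht, ht'⟩, (List.filterMap_append ..).symm, rfl, hS''⟩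

theorem symbolic_consistency (ω N : ℕ) (p : Program L) :
    {t | ∃ σ, σ.Initial p ∧ AMTrace ω N p σ t} = concSet {t | SAMTrace ω N p t} := by
  ext u
  constructor
  · rintro ⟨⟨m, a⟩, hσ, h⟩
    -- An initial configuration serves as the valuation of the symbols: under it, the initial
    -- symbolic configuration evaluates to that configuration.
    have e : (SConfig.init p).conc ⟨m, a⟩ = ⟨m, a⟩ := by
      change a .pc = _ at hσ
      rw [SConfig.conc_init, ← hσ, setReg_self]
    rw [← e] at h
    obtain ⟨t, ht, hs, rfl⟩ := h.exists_samTrace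
    exact ⟨t, ht, ⟨m, a⟩, hs, rfl⟩
  · rintro ⟨t, ht, μ, hs, rfl⟩
    refine ⟨_, ?_, SAMTrace.amTrace ht hs⟩
    rw [SConfig.conc_init]
    exact setReg_same _ _ _

end MuAsm

theorem mainTheorem3 (L : MuAsm.Lang) (ω N : ℕ) : (MuAsm.specR L ω N).IsSSS where
  oracle_overapprox := MuAsm.forall_oracle_sni_iff
  symbolic_consistency := MuAsm.symbolic_consistency ω N
  ns_consistency _ :=
    ⟨MuAsm.nsProj_image MuAsm.amTrace_iff, fun O => MuAsm.nsProj_image (MuAsm.oTrace_iff O)⟩
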